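/- \textbf{Setting.} Consider $x_{k+1}=Ax_k+Bu_k+w_k$, $y_k=Cx_k+v_k$ with independent centred Gaussian noises of covariances $Q\succ0$, $R\succ0$. Put $f(X)=AXA^\top+Q$ and let $\bar P\succeq0$ be a steady state of the Kalman filter, i.e. $\bar P=(I-\bar K C)f(\bar P)$ with $\bar K=f(\bar P)C^\top(Cf(\bar P)C^\top+R)^{-1}$. A sensor runs the filter $\hat x^s_{k+1}=p_k+\bar K(y_{k+1}-Cp_k)$, $p_k=A\hat x^s_k+Bu_k$. At each time $k=0,\dots,K$ ($K\ge1$) a controller chooses $\nu_k\in\{0,1\}$ (whether $\hat x^s_k$ is sent to it), and an attacker simultaneously chooses $a_k\in\{0,1\}$. The packet is received ($\gamma_k=1$) with probability $0$ if $\nu_k=0$, with probability $\lambda$ if $(\nu_k,a_k)=(1,0)$, and $\lambda_a$ if $(\nu_k,a_k)=(1,1)$, where $0\le\lambda_a<\lambda\le1$. The controller then chooses $u_k$. Its estimate is $\hat x_k=\hat x^s_k$ if $\nu_k\gamma_k=1$ and $\hat x_k=\bar x_k$ otherwise, where $\bar x_{k+1}=A\hat x_k+Bu_k$. The holding time is $\tau_k=0$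 if $\nu_k\gamma_k=1$ and $\tau_k=\tau_{k-1}+1$ otherwise, with given $\tau_{-1}\ge0$. At time $0$ the vectors $\bar x_0$, $\hat x_0^s-\bar x_0$, $x_0-\hat x^s_0$ are independent centred Gaussians with covariances $\Sigma_0\succeq0$, $f^{\tau_{-1}+1}(\bar P)-\bar P$ and $\bar P$; write $P_0=\Sigma_0+f^{\tau_{-1}+1}(\bar P)$ for the covariance of $x_0$. Strategies are behavioural (randomized). The controller chooses $\nu_k$ on the basis of $\bar x_0$ and of $\nu_i,\gamma_i,\nu_i\gamma_i\hat x^s_i,u_i$ for $i<k$, and then $u_k$ on the basis of these and of $\nu_k,\gamma_k,\nu_k\gamma_k\hat x^s_k$. The attacker chooses $a_k$ on the basis of $\gamma_0,\dots,\gamma_{k-1}$. With $W\succeq0$, $U\succ0$, a terminal weight $F\succeq0$, $\eta\in(0,1)$ and real costs $c_s,c_a$, the controller minimizes and the attacker maximizes $$J=\frac1K\,\mathbb E\Big[\sum_{k=0}^{K}\eta^k\big(x_k^\top Wx_k+u_k^\top Uu_k+c_s\nu_k-c_aa_k\big)+\eta^{K+1}x_{K+1}^\top Fx_{K+1}\Big]\in(-\infty,\infty].$$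 Let $S_{K+1}=F$ and, for $k=K,\dots,0$, $S_k=\eta A^\top S_{k+1}A+W-\eta^2A^\top S_{k+1}B(\eta B^\top S_{k+1}B+U)^{-1}B^\top S_{k+1}A$. (The choice $F=W$ gives the terminal condition $S_{K+1}=W$.) The \emph{reduced game} is the complete-information zero-sum Markov game whose state before stage $k$ is $\tau_{k-1}$. Its actions are $\nu_k$ (minimizer) and $a_k$ (maximizer), its transitions are those of the holding time, its strategies choose the probabilities of $\nu_k=1$ and of $a_k=1$ as functions $\sigma_k(\tau_{k-1})$, $\alpha_k(\tau_{k-1})$, and its cost is $$\hat J(\sigma,\alpha)=\mathbb E\sum_{k=0}^{K}\eta^k\Big(\operatorname{tr}\big((\eta A^\top S_{k+1}A+W-S_k)f^{\tau_k}(\bar P)\big)+c_s\nu_k-c_aa_k\Big).$$ Put $c_0=\operatorname{tr}(S_0P_0)+\sum_{k=0}^{K}\eta^{k+1}\operatorname{tr}(S_{k+1}Q)$, and let $$u_k^\star=-\eta(\eta B^\top S_{k+1}B+U)^{-1}B^\top S_{k+1}A\,\hat x_k .$$ \textbf{Corollary.} (1) If a controller strategy is a best response to some attacker strategy, then $u_k=u_k^\star$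 almost surely for all $0\le k\le K$. (2) For all holding-time strategies $\sigma,\alpha$, $J\big((u^\star,\sigma),\alpha\big)=\frac1K\big(c_0+\hat J(\sigma,\alpha)\big)$. (3) For all holding-time strategies $\sigma,\alpha$: $((u^\star,\sigma),\alpha)$ is a Nash equilibrium of the original game if and only if $(\sigma,\alpha)$ is one of the reduced game; $(u^\star,\sigma)$ solves $\min\max J$ over all strategies if and only if $\sigma$ solves $\min_\sigma\max_\alpha\hat J$; and $\alpha$ solves $\max\min J$ over all strategies if and only if it solves $\max_\alpha\min_\sigma\hat J$. (4) The reduced game has a Nash equilibrium in holding-time strategies. Its upper and lower values coincide, say with $\hat v\in\mathbb R$, and the upper and lower values of the original game both equal $\frac1K(c_0+\hat v)$. -/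

import Mathlib

open MeasureTheory ProbabilityTheory Matrix

noncomputable section

namespace DoSGame

/-- Data of the networked control problem: plant `(A, B, C)`, noise covariances `Q, R`, cost weights
`W, U` and terminal weight `F`, discount `eta`, transmission success probabilities `lam` (no attack)
and `lamA` (under attack), transmission and attack costs `cs, ca`, steady-state error covariance
`Pbar` of the sensor's Kalman filter, horizon `K`, initial holding time `t0` (the value of `τ₋₁`)
and covariance `Sig0` of the controller's prior estimate of the initial state. -/
structure Model (nx nu ny : ℕ) where
  A : Matrix (Fin nx) (Fin nx) ℝ
  B : Matrix (Fin nx) (Fin nu) ℝ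
  C : Matrix (Fin ny) (Fin nx) ℝ
  Q : Matrix (Fin nx) (Fin nx) ℝ
  R : Matrix (Fin ny) (Fin ny) ℝ
  W : Matrix (Fin nx) (Fin nx) ℝ
  U : Matrix (Fin nu) (Fin nu) ℝ
  F : Matrix (Fin nx) (Fin nx) ℝ
  eta : ℝ
  lam : ℝ
  lamA : ℝ
  cs : ℝ
  ca : ℝ
  Pbar : Matrix (Fin nx) (Fin nx) ℝ
  K : ℕ
  t0 : ℕ
  Sig0 : Matrix (Fin nx) (Fin nx) ℝ

variable {nx nu ny : ℕ}

namespace Model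

/-- One step of the open-loop error covariance, `f(X) = A X Aᵀ + Q`. -/
def f (m : Model nx nu ny) (X : Matrix (Fin nx) (Fin nx) ℝ) : Matrix (Fin nx) (Fin nx) ℝ :=
  m.A * X * m.Aᵀ + m.Q

/-- The steady-state Kalman gain `f(P̄) Cᵀ (C f(P̄) Cᵀ + R)⁻¹`. -/
def kalmanGain (m : Model nx nu ny) : Matrix (Fin nx) (Fin ny) ℝ :=
  m.f m.Pbar * m.Cᵀ * (m.C * m.f m.Pbar * m.Cᵀ + m.R)⁻¹

/-- Standing assumptions on the data. The field `steady` says that `Pbar` is a steady state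
of the error covariance recursion of the Kalman filter. -/
structure Valid (m : Model nx nu ny) : Prop where
  hQ : m.Q.PosDef
  hR : m.R.PosDef
  hW : m.W.PosSemidef
  hU : m.U.PosDef
  hF : m.F.PosSemidef
  hSig0 : m.Sig0.PosSemidef
  eta_pos : 0 < m.eta
  eta_lt : m.eta < 1
  lamA_nonneg : 0 ≤ m.lamA
  lamA_lt : m.lamA < m.lam
  lam_le : m.lam ≤ 1
  hPbar : m.Pbar.PosSemidef
  steady : m.Pbar = (1 - m.kalmanGain * m.C) * m.f m.Pbar
  hK : 1 ≤ m.K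

/-! ### Riccati recursion and feedback gain -/

/-- The discounted Riccati map. -/
def riccatiMap (m : Model nx nu ny) (S : Matrix (Fin nx) (Fin nx) ℝ) :
    Matrix (Fin nx) (Fin nx) ℝ :=
  m.eta • (m.Aᵀ * S * m.A) + m.W
    - m.eta ^ 2 • (m.Aᵀ * S * m.B * (m.eta • (m.Bᵀ * S * m.B) + m.U)⁻¹ * m.Bᵀ * S * m.A)

/-- `S k` for `0 ≤ k ≤ K + 1`: the backward recursion started at `S (K + 1) = F`. -/
def S (m : Model nx nu ny) (k : ℕ) : Matrix (Fin nx) (Fin nx) ℝ :=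
  m.riccatiMap^[m.K + 1 - k] m.F

theorem S_terminal (m : Model nx nu ny) : m.S (m.K + 1) = m.F := by
  simp [S]

theorem S_step (m : Model nx nu ny) {k : ℕ} (hk : k ≤ m.K) :
    m.S k = m.riccatiMap (m.S (k + 1)) := by
  have h : m.K + 1 - k = (m.K + 1 - (k + 1)) + 1 := by omega
  rw [S, h, Function.iterate_succ_apply', S]

/-- The matrix `L k` such that the optimal control is `u_k = - L k x̂_k`. -/
def L (m : Model nx nu ny) (k : ℕ) : Matrix (Fin nu) (Fin nx) ℝ :=
  m.eta • ((m.eta • (m.Bᵀ * m.S (k + 1) * m.B) + m.U)⁻¹ * m.Bᵀ * m.S (k + 1) * m.A)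

/-- Probability that a packet sent at a time with attack decision `a` is received. -/
def succProb (m : Model nx nu ny) (a : Bool) : ℝ := if a then m.lamA else m.lam

end Model

/-! ### Information and strategies -/

/-- What the controller records in one stage: `(ν, γ, ν γ x̂ˢ, u)`. -/
abbrev Rec (nx nu : ℕ) : Type := Bool × Bool × (Fin nx → ℝ) × (Fin nu → ℝ)

/-- What the controller knows before it acts at time `k`: the prior estimate `x̄₀` and the records
of the stages `0, …, k - 1`. -/
abbrev Info (nx nu k : ℕ) : Type := (Fin nx → ℝ) × (Fin k → Rec nx nu)

/-- A behavioural strategy of the controller. At time `k` it first draws `ν_k`, equal to `1` with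
probability `sched k` of its information; then it sees `(ν_k, γ_k, ν_k γ_k x̂ˢ_k)` and chooses the
input `u_k`, possibly with the help of an independent uniform seed. -/
structure ControllerPolicy (nx nu : ℕ) where
  sched : (k : ℕ) → Info nx nu k → unitInterval
  input : (k : ℕ) → Info nx nu k → Bool × Bool × (Fin nx → ℝ) → unitInterval → (Fin nu → ℝ)
  measurable_sched : ∀ k, Measurable (sched k)
  measurable_input : ∀ k, Measurable
    (fun p : Info nx nu k × (Bool × Bool × (Fin nx → ℝ)) × unitInterval =>
      input k p.1 p.2.1 p.2.2)

/-- A behavioural strategy of the attacker: the probability of `a_k = 1` as a function of the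
acknowledgments `γ₀, …, γ_{k-1}` it has overheard. -/
abbrev AttackPolicy : Type := (k : ℕ) → (Fin k → Bool) → unitInterval

/-- A behavioural strategy that uses only the holding time: `σ k t` is the probability of
choosing `1` at time `k` when `τ_{k-1} = t`. -/
abbrev HoldingPolicy : Type := ℕ → ℕ → unitInterval

/-- The holding time `τ_{k-1}` as a function of `γ₀, …, γ_{k-1}` (note that `γ_i = 1` forces
`ν_i = 1`, so `ν_i γ_i = γ_i`). -/
def holdingTime (t0 : ℕ) : (k : ℕ) → (Fin k → Bool) → ℕ
  | 0, _ => t0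
  | k + 1, g => if g (Fin.last k) then 0 else holdingTime t0 k (fun i => g i.castSucc) + 1

/-- The attack strategy in the full game given by a strategy in the holding time. -/
def HoldingPolicy.toAttack (t0 : ℕ) (α : HoldingPolicy) : AttackPolicy :=
  fun k g => α k (holdingTime t0 k g)

namespace Model

/-- The controller's predicted estimate `x̄_k = A x̂_{k-1} + B u_{k-1}`, where `x̂_j = x̂ˢ_j` if
`ν_j γ_j = 1` and `x̂_j = x̄_j` otherwise. -/
def predEstimate (m : Model nx nu ny) : (k : ℕ) → Info nx nu k → (Fin nx → ℝ)
  | 0, I => I.1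
  | k + 1, I =>
      m.A *ᵥ (if (I.2 (Fin.last k)).1 && (I.2 (Fin.last k)).2.1 then (I.2 (Fin.last k)).2.2.1
        else predEstimate m k (I.1, fun i => I.2 i.castSucc))
      + m.B *ᵥ (I.2 (Fin.last k)).2.2.2

/-- The controller's estimate `x̂_k` once `(ν_k, γ_k, ν_k γ_k x̂ˢ_k)` is known. -/
def estimate (m : Model nx nu ny) (k : ℕ) (I : Info nx nu k)
    (o : Bool × Bool × (Fin nx → ℝ)) : Fin nx → ℝ :=
  if o.1 && o.2.1 then o.2.2 else m.predEstimate k I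

theorem measurable_predEstimate (m : Model nx nu ny) (k : ℕ) :
    Measurable (m.predEstimate k) := by
  induction k with
  | zero => exact measurable_fst
  | succ k ih =>
    have hl : Measurable (fun I : Info nx nu (k + 1) => I.2 (Fin.last k)) :=
      (measurable_pi_apply _).comp measurable_snd
    have hi : Measurable (fun I : Info nx nu (k + 1) =>
        ((I.1, fun i : Fin k => I.2 i.castSucc) : Info nx nu k)) :=
      measurable_fst.prodMk
        (measurable_pi_lambda _ fun i => (measurable_pi_apply _).comp measurable_snd)
    have hb : Measurable (fun I : Info nx nu (k + 1) =>
        (I.2 (Fin.last k)).1 && (I.2 (Fin.last k)).2.1) :=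
      (measurable_of_finite (fun p : Bool × Bool => p.1 && p.2)).comp
        ((measurable_fst.comp hl).prodMk (measurable_fst.comp (measurable_snd.comp hl)))
    have hA : Measurable (fun v : Fin nx → ℝ => m.A *ᵥ v) :=
      (Continuous.matrix_mulVec continuous_const continuous_id).measurable
    have hB : Measurable (fun v : Fin nu → ℝ => m.B *ᵥ v) :=
      (Continuous.matrix_mulVec continuous_const continuous_id).measurable
    have hif : Measurable (fun I : Info nx nu (k + 1) =>
        if (I.2 (Fin.last k)).1 && (I.2 (Fin.last k)).2.1 then (I.2 (Fin.last k)).2.2.1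
          else m.predEstimate k (I.1, fun i => I.2 i.castSucc)) :=
      Measurable.ite (hb (measurableSet_singleton true))
        (measurable_fst.comp (measurable_snd.comp (measurable_snd.comp hl))) (ih.comp hi)
    exact (hA.comp hif).add
      (hB.comp (measurable_snd.comp (measurable_snd.comp (measurable_snd.comp hl))))

/-- The separated strategy: schedule by the holding time with `σ`, and apply the linear
control `u_k = - L k x̂_k`. -/
def separated (m : Model nx nu ny) (σ : HoldingPolicy) : ControllerPolicy nx nu where
  sched k I := σ k (holdingTime m.t0 k fun i => (I.2 i).2.1)
  input k I o _ := -(m.L k *ᵥ m.estimate k I o)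
  measurable_sched k := by
    refine (measurable_of_finite (fun g : Fin k → Bool => σ k (holdingTime m.t0 k g))).comp ?_
    exact measurable_pi_lambda _ fun i => measurable_fst.comp (measurable_snd.comp
      ((measurable_pi_apply i).comp measurable_snd))
  measurable_input k := by
    have hL : Measurable (fun v : Fin nx → ℝ => -(m.L k *ᵥ v)) :=
      (Continuous.matrix_mulVec continuous_const continuous_id).neg.measurable
    refine hL.comp (Measurable.ite (?_ : MeasurableSet _) ?_ ?_)
    · have hb : Measurable (fun p : Info nx nu k × (Bool × Bool × (Fin nx → ℝ)) × unitInterval =>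
          p.2.1.1 && p.2.1.2.1) :=
        (measurable_of_finite (fun p : Bool × Bool => p.1 && p.2)).comp
          (by fun_prop :
            Measurable (fun p : Info nx nu k × (Bool × Bool × (Fin nx → ℝ)) × unitInterval =>
              (p.2.1.1, p.2.1.2.1)))
      exact hb (measurableSet_singleton true)
    · fun_prop
    · exact (m.measurable_predEstimate k).comp measurable_fst

end Model

/-! ### Randomness -/

/-- The centred Gaussian law on `ℝⁿ` with covariance matrix `V`. -/
def gaussianVec {n : ℕ} (V : Matrix (Fin n) (Fin n) ℝ) : Measure (Fin n → ℝ) :=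
  (multivariateGaussian 0 V).map WithLp.ofLp

instance {n : ℕ} (V : Matrix (Fin n) (Fin n) ℝ) : IsProbabilityMeasure (gaussianVec V) :=
  Measure.isProbabilityMeasure_map (WithLp.measurable_ofLp 2 _).aemeasurable

/-- The randomness of stage `k`: `(w_k, v_{k+1})`, the uniform seeds with which `ν_k`, `u_k` and
`a_k` are drawn, and the uniform seed of the channel. -/
abbrev StageNoise (nx ny : ℕ) : Type :=
  (Fin nx → ℝ) × (Fin ny → ℝ) × unitInterval × unitInterval × unitInterval × unitInterval

/-- Sample points: `((x̄₀, x̂ˢ₀ - x̄₀, x₀ - x̂ˢ₀), stage randomness)`. -/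
abbrev Sample (nx ny : ℕ) : Type :=
  ((Fin nx → ℝ) × (Fin nx → ℝ) × (Fin nx → ℝ)) × (ℕ → StageNoise nx ny)

namespace Model

/-- The law of the randomness: all components are independent. At time `0` the sensor's filter is
in steady state, so `x₀ - x̂ˢ₀` has covariance `P̄`, and the controller's prediction `x̄₀` has error
covariance `f^{τ₋₁ + 1}(P̄)`. -/
def law (m : Model nx nu ny) : Measure (Sample nx ny) :=
  ((gaussianVec m.Sig0).prod
    ((gaussianVec (m.f^[m.t0 + 1] m.Pbar - m.Pbar)).prod (gaussianVec m.Pbar))).prod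
  (Measure.infinitePi fun _ : ℕ =>
    (gaussianVec m.Q).prod ((gaussianVec m.R).prod
      ((volume : Measure unitInterval).prod ((volume : Measure unitInterval).prod
        ((volume : Measure unitInterval).prod (volume : Measure unitInterval))))))

end Model

/-! ### The closed loop -/

/-- The configuration before the decisions of time `k`: the state `x_k`, the sensor's estimate
`x̂ˢ_k`, and the records of the earlier stages. -/
structure Config (nx nu k : ℕ) where
  x : Fin nx → ℝ
  xs : Fin nx → ℝ
  hist : Fin k → Rec nx nu

namespace Config

variable {k : ℕ}

/-- The controller's information. -/
def info (c : Config nx nu k) (ω : Sample nx ny) : Info nx nu k := (ω.1.1, c.hist)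

/-- The scheduling command `ν_k`. -/
def sched (c : Config nx nu k) (pol : ControllerPolicy nx nu) (ω : Sample nx ny) : Bool :=
  decide ((ω.2 k).2.2.1 < pol.sched k (c.info ω))

/-- The attack decision `a_k`. -/
def attack (c : Config nx nu k) (α : AttackPolicy) (ω : Sample nx ny) : Bool :=
  decide ((ω.2 k).2.2.2.2.1 < α k fun i => (c.hist i).2.1)

/-- The arrival indicator `γ_k`: never `1` if `ν_k = 0`, and otherwise `1` with probability
`lamA` or `lam` according as there is an attack or not. -/
def arrival (m : Model nx nu ny) (c : Config nx nu k) (pol : ControllerPolicy nx nu)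
    (α : AttackPolicy) (ω : Sample nx ny) : Bool :=
  c.sched pol ω && decide (((ω.2 k).2.2.2.2.2 : ℝ) < m.succProb (c.attack α ω))

/-- The observation `(ν_k, γ_k, ν_k γ_k x̂ˢ_k)` before the input is chosen. -/
def obs (m : Model nx nu ny) (c : Config nx nu k) (pol : ControllerPolicy nx nu)
    (α : AttackPolicy) (ω : Sample nx ny) : Bool × Bool × (Fin nx → ℝ) :=
  (c.sched pol ω, c.arrival m pol α ω,
    if c.sched pol ω && c.arrival m pol α ω then c.xs else 0)

/-- The control input `u_k`. -/
def input (m : Model nx nu ny) (c : Config nx nu k) (pol : ControllerPolicy nx nu)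
    (α : AttackPolicy) (ω : Sample nx ny) : Fin nu → ℝ :=
  pol.input k (c.info ω) (c.obs m pol α ω) (ω.2 k).2.2.2.1

/-- The next state `x_{k+1} = A x_k + B u_k + w_k`. -/
def nextState (m : Model nx nu ny) (c : Config nx nu k) (pol : ControllerPolicy nx nu)
    (α : AttackPolicy) (ω : Sample nx ny) : Fin nx → ℝ :=
  m.A *ᵥ c.x + m.B *ᵥ c.input m pol α ω + (ω.2 k).1

/-- The next output `y_{k+1} = C x_{k+1} + v_{k+1}`. -/
def nextOutput (m : Model nx nu ny) (c : Config nx nu k) (pol : ControllerPolicy nx nu)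
    (α : AttackPolicy) (ω : Sample nx ny) : Fin ny → ℝ :=
  m.C *ᵥ c.nextState m pol α ω + (ω.2 k).2.1

/-- The sensor's prediction `A x̂ˢ_k + B u_k`. -/
def sensorPred (m : Model nx nu ny) (c : Config nx nu k) (pol : ControllerPolicy nx nu)
    (α : AttackPolicy) (ω : Sample nx ny) : Fin nx → ℝ :=
  m.A *ᵥ c.xs + m.B *ᵥ c.input m pol α ω

/-- The configuration at time `k + 1`; the sensor runs its Kalman filter. -/
def next (m : Model nx nu ny) (c : Config nx nu k) (pol : ControllerPolicy nx nu)
    (α : AttackPolicy) (ω : Sample nx ny) : Config nx nu (k + 1) where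
  x := c.nextState m pol α ω
  xs := c.sensorPred m pol α ω + m.kalmanGain *ᵥ
    (c.nextOutput m pol α ω - m.C *ᵥ c.sensorPred m pol α ω)
  hist := Fin.snoc (α := fun _ => Rec nx nu) c.hist
    ((c.obs m pol α ω).1, (c.obs m pol α ω).2.1, (c.obs m pol α ω).2.2, c.input m pol α ω)

end Config

namespace Model

/-- The configuration at time `k` of the closed loop. -/
def run (m : Model nx nu ny) (pol : ControllerPolicy nx nu) (α : AttackPolicy)
    (ω : Sample nx ny) : (k : ℕ) → Config nx nu k
  | 0 => ⟨ω.1.1 + ω.1.2.1 + ω.1.2.2, ω.1.1 + ω.1.2.1, Fin.elim0⟩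
  | k + 1 => (run m pol α ω k).next m pol α ω

/-- The input `u_k` of the closed loop. -/
def inputAt (m : Model nx nu ny) (pol : ControllerPolicy nx nu) (α : AttackPolicy) (k : ℕ)
    (ω : Sample nx ny) : Fin nu → ℝ :=
  (m.run pol α ω k).input m pol α ω

/-- The controller's estimate `x̂_k` in the closed loop. -/
def estimateAt (m : Model nx nu ny) (pol : ControllerPolicy nx nu) (α : AttackPolicy) (k : ℕ)
    (ω : Sample nx ny) : Fin nx → ℝ :=
  m.estimate k ((m.run pol α ω k).info ω) ((m.run pol α ω k).obs m pol α ω)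

/-- The quadratic part of the realised cost, including the terminal cost. -/
def quadCost (m : Model nx nu ny) (pol : ControllerPolicy nx nu) (α : AttackPolicy)
    (ω : Sample nx ny) : ℝ :=
  ∑ k ∈ Finset.range (m.K + 1), m.eta ^ k *
    ((m.run pol α ω k).x ⬝ᵥ m.W *ᵥ (m.run pol α ω k).x
      + m.inputAt pol α k ω ⬝ᵥ m.U *ᵥ m.inputAt pol α k ω)
  + m.eta ^ (m.K + 1) *
    ((m.run pol α ω (m.K + 1)).x ⬝ᵥ m.F *ᵥ (m.run pol α ω (m.K + 1)).x)

/-- The communication cost `c_s ν - c_a a`. -/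
def commCost (m : Model nx nu ny) (v a : Bool) : ℝ :=
  (if v then m.cs else 0) - (if a then m.ca else 0)

/-- The expected cost of the game. The quadratic part is nonnegative and may have infinite
expectation, so the cost takes values in the extended reals. -/
def J (m : Model nx nu ny) (pol : ControllerPolicy nx nu) (α : AttackPolicy) : EReal :=
  (((m.K : ℝ)⁻¹ : ℝ) : EReal) *
    (((∫⁻ ω, ENNReal.ofReal (m.quadCost pol α ω) ∂m.law : ENNReal) : EReal)
      + ((∫ ω, ∑ k ∈ Finset.range (m.K + 1), m.eta ^ k *
          m.commCost ((m.run pol α ω k).sched pol ω) ((m.run pol α ω k).attack α ω)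
            ∂m.law : ℝ) : EReal))

/-! ### The complete-information game in the holding time -/

/-- Transition probability of the holding time from `τ_{k-1} = t` to `τ_k = t'`. -/
def trans (m : Model nx nu ny) (t : ℕ) (v a : Bool) (t' : ℕ) : ℝ :=
  if t' = 0 then (if v then m.succProb a else 0)
  else if t' = t + 1 then 1 - (if v then m.succProb a else 0)
  else 0

/-- Stage cost `tr((η Aᵀ S_{k+1} A + W - S_k) f^{τ_k}(P̄)) + c_s ν_k - c_a a_k`. -/
def stageCost (m : Model nx nu ny) (k t' : ℕ) (v a : Bool) : ℝ :=
  Matrix.trace ((m.eta • (m.Aᵀ * m.S (k + 1) * m.A) + m.W - m.S k) * m.f^[t'] m.Pbar)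
    + m.commCost v a

/-- The probability of `b` under the two-point law with `P(true) = q`. -/
def prob (q : unitInterval) (b : Bool) : ℝ := if b then (q : ℝ) else 1 - (q : ℝ)

/-- Expected discounted cost over the `n` stages `k, …, k + n - 1` of the Markov game, starting
from `τ_{k-1} = t`, when the actions are drawn independently according to `σ` and `α`. -/
def costToGo (m : Model nx nu ny) (σ α : HoldingPolicy) : (n k t : ℕ) → ℝ
  | 0, _, _ => 0
  | n + 1, k, t => ∑ v : Bool, ∑ a : Bool, prob (σ k t) v * prob (α k t) a *
      ∑ t' ∈ ({0, t + 1} : Finset ℕ),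
        m.trans t v a t' * (m.stageCost k t' v a + m.eta * costToGo m σ α n (k + 1) t')

/-- Expected total cost of the complete-information game over the stages `0, …, K`. -/
def Jred (m : Model nx nu ny) (σ α : HoldingPolicy) : ℝ :=
  m.costToGo σ α (m.K + 1) 0 m.t0

/-- The part of the cost that no strategy influences: `tr(S₀ P₀) + ∑ η^{k+1} tr(S_{k+1} Q)`,
where `P₀` is the covariance of `x₀`. -/
def baseCost (m : Model nx nu ny) : ℝ :=
  Matrix.trace (m.S 0 * (m.Sig0 + m.f^[m.t0 + 1] m.Pbar))
    + ∑ k ∈ Finset.range (m.K + 1), m.eta ^ (k + 1) * Matrix.trace (m.S (k + 1) * m.Q)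

end Model

/-! ### Solution notions for zero-sum games (first player minimizes) -/

/-- `(p, q)` is a Nash equilibrium (saddle point) of the zero-sum game with cost `c`. -/
def IsNash {P D : Type*} (c : P → D → EReal) (p : P) (q : D) : Prop :=
  (∀ q', c p q' ≤ c p q) ∧ ∀ p', c p q ≤ c p' q

/-- `p` solves `min_p max_q c p q`. -/
def IsMinimax {P D : Type*} (c : P → D → EReal) (p : P) : Prop :=
  ∀ p', (⨆ q, c p q) ≤ ⨆ q, c p' q

/-- `q` solves `max_q min_p c p q`. -/
def IsMaximin {P D : Type*} (c : P → D → EReal) (q : D) : Prop :=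
  ∀ q', (⨅ p, c p q') ≤ ⨅ p, c p q

end DoSGame

end

/-!
The controller's cost splits into three parts that can be optimised separately.

*Errors are Gaussian whatever the strategies.* Write `x_k = x̄_k + d_k + e_k`, with `d_k` the gap
between the sensor's estimate and the controller's prediction and `e_k` the sensor's error. In
steady state the correction of the sensor's filter and its new error are independent with
covariances `f(P̄) - P̄` and `P̄` (`Model.Valid.map_correction_error`). The decisions and inputs
depend on `d_k` only through packets that have arrived, after which the gap is reset. Hence, given
the controller's information, `d_k` and `e_k` are independent centred Gaussians with covariances
`f^{τ+1}(P̄) - P̄` and `P̄`, where `τ` is the current holding time (`Model.lintegral_loopState`).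

*Separation.* Completing the square with the Riccati matrices and telescoping turns the expected
quadratic cost into a constant, the expected cost of `u_k + L_k x̂_k`, and the expectation of
`tr((η Aᵀ S_{k+1} A + W - S_k) f^{τ_k}(P̄))`. All the terms are nonnegative, so the identity is
proved for Lebesgue integrals with values in `[0, ∞]`, without any integrability assumption on the
inputs. The remaining cost depends only on the joint law of decisions and arrivals. Averaging the
scheduling probability over the controller's information given the acknowledgments represents it
as the cost of a finite game on acknowledgment histories (`Model.J_eq`). So
`K J = deviation + c₀ + cost on histories`, and the linear control with the averaged
scheduling rule makes the deviation vanish and leaves the rest unchanged. A best response therefore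
has zero deviation cost, which forces `u_k = -L_k x̂_k` almost surely.

*The finite game.* The stage costs and transitions depend on the history only through the holding
time, so backward induction with the minimax theorem for 2 × 2 games gives holding-time strategies
that form a saddle point against all history-dependent strategies. Carrying out the induction with
each player restricted to a given interval of mixed actions covers the saddle point and the two
best-response problems at once (`Model.exists_saddle_histCost`). A holding-time strategy thus has
the same worst case in the full game as in the reduced game, up to the affine map `Model.scale`, and
the equivalences and values follow.
-/

noncomputable section

namespace DoSGame

/-! ### Bilinear forms of matrices -/

section Quadratic

variable {n p : ℕ}

/-- The quadratic form `x ↦ xᵀ S x` of a square matrix. -/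
def quad (S : Matrix (Fin n) (Fin n) ℝ) (x : Fin n → ℝ) : ℝ := x ⬝ᵥ S *ᵥ x

theorem quad_nonneg {S : Matrix (Fin n) (Fin n) ℝ} (hS : S.PosSemidef) (x : Fin n → ℝ) :
    0 ≤ quad S x := by
  simpa [quad] using hS.dotProduct_mulVec_nonneg x

theorem continuous_quad (S : Matrix (Fin n) (Fin n) ℝ) : Continuous (quad S) :=
  continuous_id.dotProduct (Continuous.matrix_mulVec continuous_const continuous_id)

theorem PosSemidef.transpose_eq {S : Matrix (Fin n) (Fin n) ℝ} (hS : S.PosSemidef) : Sᵀ = S := by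
  have h := hS.isHermitian.eq
  rwa [conjTranspose_eq_transpose_of_trivial] at h

theorem PosSemidef.congr_transpose {S : Matrix (Fin n) (Fin n) ℝ} (hS : S.PosSemidef)
    (N : Matrix (Fin n) (Fin p) ℝ) : (Nᵀ * S * N).PosSemidef := by
  simpa [conjTranspose_eq_transpose_of_trivial] using hS.conjTranspose_mul_mul_same N

theorem PosSemidef.congr {S : Matrix (Fin n) (Fin n) ℝ} (hS : S.PosSemidef)
    (N : Matrix (Fin p) (Fin n) ℝ) : (N * S * Nᵀ).PosSemidef := by
  simpa [conjTranspose_eq_transpose_of_trivial] using hS.mul_mul_conjTranspose_same N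

theorem dotProduct_mulVec_comm {S : Matrix (Fin n) (Fin n) ℝ} (hS : Sᵀ = S) (x y : Fin n → ℝ) :
    x ⬝ᵥ S *ᵥ y = y ⬝ᵥ S *ᵥ x := by
  rw [dotProduct_mulVec, ← mulVec_transpose, hS, dotProduct_comm]

theorem mulVec_dotProduct_eq (N : Matrix (Fin n) (Fin p) ℝ) (x : Fin p → ℝ) (y : Fin n → ℝ) :
    (N *ᵥ x) ⬝ᵥ y = x ⬝ᵥ Nᵀ *ᵥ y := by
  rw [dotProduct_mulVec, vecMul_transpose]

theorem quad_add {S : Matrix (Fin n) (Fin n) ℝ} (hS : Sᵀ = S) (x y : Fin n → ℝ) :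
    quad S (x + y) = quad S x + 2 * (x ⬝ᵥ S *ᵥ y) + quad S y := by
  simp only [quad, mulVec_add, dotProduct_add, add_dotProduct]
  rw [dotProduct_mulVec_comm hS y x]
  ring

theorem quad_mulVec (S : Matrix (Fin n) (Fin n) ℝ) (N : Matrix (Fin n) (Fin p) ℝ)
    (x : Fin p → ℝ) : quad S (N *ᵥ x) = quad (Nᵀ * S * N) x := by
  simp only [quad, mulVec_dotProduct_eq, mulVec_mulVec, Matrix.mul_assoc]

theorem quad_add_matrix (S T : Matrix (Fin n) (Fin n) ℝ) (x : Fin n → ℝ) :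
    quad (S + T) x = quad S x + quad T x := by
  simp [quad, add_mulVec, dotProduct_add]

theorem quad_smul_matrix (c : ℝ) (S : Matrix (Fin n) (Fin n) ℝ) (x : Fin n → ℝ) :
    quad (c • S) x = c * quad S x := by
  simp [quad, smul_mulVec, dotProduct_smul]

theorem quad_eq_zero {S : Matrix (Fin n) (Fin n) ℝ} (hS : S.PosDef) {x : Fin n → ℝ}
    (h : quad S x = 0) : x = 0 := by
  by_contra hx
  have := hS.dotProduct_mulVec_pos hx
  simp only [star_trivial] at this
  exact this.ne' h

end Quadratic

/-! ### Gaussian vectors -/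

section Gaussian

variable {n p : ℕ}

instance isGaussian_gaussianVec (V : Matrix (Fin n) (Fin n) ℝ) : IsGaussian (gaussianVec V) :=
  inferInstanceAs (IsGaussian ((multivariateGaussian 0 V).map
    (PiLp.continuousLinearEquiv 2 ℝ (fun _ : Fin n => ℝ) :
      EuclideanSpace ℝ (Fin n) →L[ℝ] (Fin n → ℝ))))

/-- The vector representing a continuous linear functional on `ℝⁿ`. -/
def dualVec (l : StrongDual ℝ (Fin n → ℝ)) : Fin n → ℝ := fun i => l (Pi.single i 1)

theorem dual_apply (l : StrongDual ℝ (Fin n → ℝ)) (x : Fin n → ℝ) : l x = dualVec l ⬝ᵥ x := by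
  conv_lhs => rw [show x = ∑ i, x i • (Pi.single i (1 : ℝ) : Fin n → ℝ) from by
    ext j; simp [Finset.sum_apply, Pi.single_apply]]
  simp [dualVec, dotProduct, mul_comm]

theorem dualVec_eq {l : StrongDual ℝ (Fin n → ℝ)} {a : Fin n → ℝ} (h : ∀ x, l x = a ⬝ᵥ x) :
    dualVec l = a := by
  ext i
  simp [dualVec, h]

theorem charFunDual_gaussianVec {V : Matrix (Fin n) (Fin n) ℝ} (hV : V.PosSemidef)
    (l : StrongDual ℝ (Fin n → ℝ)) :
    charFunDual (gaussianVec V) l = Complex.exp (-(quad V (dualVec l) : ℝ) / 2) := by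
  have h1 : gaussianVec V = (multivariateGaussian 0 V).map
    (PiLp.continuousLinearEquiv 2 ℝ (fun _ : Fin n => ℝ) :
      EuclideanSpace ℝ (Fin n) →L[ℝ] (Fin n → ℝ)) := rfl
  rw [h1, charFunDual_map]
  have h2 := charFun_multivariateGaussian (μ := 0) hV (WithLp.toLp 2 (dualVec l))
  simp only [inner_zero_right, Complex.ofReal_zero, zero_mul, zero_sub] at h2
  rw [quad, neg_div]
  refine Eq.trans ?_ h2
  rw [charFunDual_apply, charFun_apply]
  congr 1
  ext x
  congr 3
  simp [dual_apply, PiLp.inner_apply, dotProduct]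

theorem integral_gaussianVec (V : Matrix (Fin n) (Fin n) ℝ) {g : (Fin n → ℝ) → ℝ}
    (hg : Continuous g) :
    ∫ x, g x ∂(gaussianVec V) = ∫ x, g (WithLp.ofLp x) ∂(multivariateGaussian 0 V) :=
  integral_map (WithLp.measurable_ofLp 2 _).aemeasurable hg.aestronglyMeasurable

theorem integral_eval_gaussianVec (V : Matrix (Fin n) (Fin n) ℝ) (i : Fin n) :
    ∫ x, x i ∂(gaussianVec V) = 0 := by
  rw [integral_gaussianVec V (continuous_apply i)]
  have h := integral_id_multivariateGaussian (μ := (0 : EuclideanSpace ℝ (Fin n))) (S := V)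
  have h2 := ContinuousLinearMap.integral_comp_comm
    (EuclideanSpace.proj i : EuclideanSpace ℝ (Fin n) →L[ℝ] ℝ)
    (φ := fun x => x) (IsGaussian.integrable_id (μ := multivariateGaussian 0 V))
  rw [h] at h2
  simpa using h2

theorem memLp_eval_gaussianVec (V : Matrix (Fin n) (Fin n) ℝ) (i : Fin n) :
    MemLp (fun x => x i) 2 (gaussianVec V) :=
  (ContinuousLinearMap.proj (R := ℝ) (φ := fun _ : Fin n => ℝ) i).comp_memLp'
    (IsGaussian.memLp_two_id (μ := gaussianVec V))

theorem integrable_eval_gaussianVec (V : Matrix (Fin n) (Fin n) ℝ) (i : Fin n) :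
    Integrable (fun x => x i) (gaussianVec V) :=
  (memLp_eval_gaussianVec V i).integrable (by norm_num)

theorem integrable_mul_eval_gaussianVec (V : Matrix (Fin n) (Fin n) ℝ) (i j : Fin n) :
    Integrable (fun x => x i * x j) (gaussianVec V) :=
  (memLp_eval_gaussianVec V i).integrable_mul (memLp_eval_gaussianVec V j)

theorem integral_mul_eval_gaussianVec {V : Matrix (Fin n) (Fin n) ℝ} (hV : V.PosSemidef)
    (i j : Fin n) : ∫ x, x i * x j ∂(gaussianVec V) = V i j := by
  have h := covariance_eval_multivariateGaussian (μ := 0) hV i j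
  have hz : ∀ i, ∫ x : EuclideanSpace ℝ (Fin n), x i ∂(multivariateGaussian 0 V) = 0 := by
    intro i
    have := integral_eval_gaussianVec V i
    rwa [integral_gaussianVec V (continuous_apply i)] at this
  rw [covariance, hz, hz] at h
  rw [integral_gaussianVec V (g := fun x => x i * x j) (by fun_prop)]
  simpa using h

theorem quad_eq_sum (S : Matrix (Fin n) (Fin n) ℝ) (x : Fin n → ℝ) :
    quad S x = ∑ i, ∑ j, S i j * (x i * x j) := by
  simp only [quad, dotProduct, mulVec, Finset.mul_sum]
  exact Finset.sum_congr rfl fun i _ => Finset.sum_congr rfl fun j _ => by ring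

theorem integrable_quad_gaussianVec (S V : Matrix (Fin n) (Fin n) ℝ) :
    Integrable (quad S) (gaussianVec V) := by
  have h : quad S = fun x => ∑ i, ∑ j, S i j * (x i * x j) := funext (quad_eq_sum S)
  rw [h]
  exact integrable_finsetSum _ fun i _ => integrable_finsetSum _ fun j _ =>
    (integrable_mul_eval_gaussianVec V i j).const_mul _

theorem integral_quad_gaussianVec (S : Matrix (Fin n) (Fin n) ℝ) {V : Matrix (Fin n) (Fin n) ℝ}
    (hV : V.PosSemidef) : ∫ x, quad S x ∂(gaussianVec V) = trace (S * V) := by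
  simp only [quad_eq_sum]
  refine (integral_finsetSum _ fun i _ => integrable_finsetSum _ fun j _ =>
    (integrable_mul_eval_gaussianVec V i j).const_mul _).trans ?_
  simp only [trace, diag_apply, Matrix.mul_apply]
  refine Finset.sum_congr rfl fun i _ => ?_
  refine (integral_finsetSum _ fun j _ =>
    (integrable_mul_eval_gaussianVec V i j).const_mul _).trans ?_
  refine Finset.sum_congr rfl fun j _ => ?_
  rw [integral_const_mul, integral_mul_eval_gaussianVec hV]
  exact congrArg (S i j * ·) (congrFun (congrFun (PosSemidef.transpose_eq hV) j) i)

theorem trace_mul_nonneg {S V : Matrix (Fin n) (Fin n) ℝ} (hS : S.PosSemidef)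
    (hV : V.PosSemidef) : 0 ≤ trace (S * V) := by
  rw [← integral_quad_gaussianVec S hV]
  exact integral_nonneg fun x => quad_nonneg hS x

/-- The second moment of a Gaussian vector: shifting the argument adds no cross term. -/
theorem lintegral_quad_add_gaussianVec {S : Matrix (Fin p) (Fin p) ℝ} (hS : S.PosSemidef)
    {V : Matrix (Fin n) (Fin n) ℝ} (hV : V.PosSemidef) (N : Matrix (Fin p) (Fin n) ℝ)
    (z : Fin p → ℝ) :
    ∫⁻ x, ENNReal.ofReal (quad S (z + N *ᵥ x)) ∂(gaussianVec V) =
      ENNReal.ofReal (quad S z + trace (Nᵀ * S * N * V)) := by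
  have hlin : ∀ x, z ⬝ᵥ S *ᵥ (N *ᵥ x) = ∑ i, ((S * N)ᵀ *ᵥ z) i * x i := by
    intro x
    rw [mulVec_mulVec, dotProduct_mulVec, ← mulVec_transpose]
    rfl
  have hI : Integrable (fun x => z ⬝ᵥ S *ᵥ (N *ᵥ x)) (gaussianVec V) := by
    simp only [hlin]
    exact integrable_finsetSum _ fun i _ => (integrable_eval_gaussianVec V i).const_mul _
  have h0 : ∫ x, z ⬝ᵥ S *ᵥ (N *ᵥ x) ∂(gaussianVec V) = 0 := by
    simp only [hlin]
    rw [integral_finsetSum _ fun i _ => (integrable_eval_gaussianVec V i).const_mul _]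
    exact Finset.sum_eq_zero fun i _ => by
      rw [integral_const_mul, integral_eval_gaussianVec, mul_zero]
  have hq : ∀ x, quad S (z + N *ᵥ x) =
      quad S z + 2 * (z ⬝ᵥ S *ᵥ (N *ᵥ x)) + quad (Nᵀ * S * N) x := by
    intro x
    rw [quad_add (PosSemidef.transpose_eq hS), quad_mulVec]
  have hint : Integrable (fun x => quad S (z + N *ᵥ x)) (gaussianVec V) := by
    simp only [hq]
    exact ((integrable_const _).add (hI.const_mul 2)).add (integrable_quad_gaussianVec _ V)
  rw [← ofReal_integral_eq_lintegral_ofReal hint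
    (Filter.Eventually.of_forall fun x => quad_nonneg hS _)]
  congr 1
  simp only [hq]
  refine (integral_add ((integrable_const _).add (hI.const_mul 2))
    (integrable_quad_gaussianVec _ V)).trans ?_
  rw [integral_quad_gaussianVec _ hV]
  congr 1
  refine (integral_add (integrable_const _) (hI.const_mul 2)).trans ?_
  rw [integral_const_mul, h0]
  simp

/-- The sum of a linear image of a centred Gaussian vector and an independent one. -/
theorem map_add_gaussianVec {V : Matrix (Fin n) (Fin n) ℝ} (hV : V.PosSemidef)
    {V' : Matrix (Fin p) (Fin p) ℝ} (hV' : V'.PosSemidef) (N : Matrix (Fin p) (Fin n) ℝ) :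
    ((gaussianVec V).prod (gaussianVec V')).map (fun x => N *ᵥ x.1 + x.2) =
      gaussianVec (N * V * Nᵀ + V') := by
  let T : (Fin n → ℝ) × (Fin p → ℝ) →L[ℝ] (Fin p → ℝ) :=
    (LinearMap.toContinuousLinearMap N.mulVecLin).comp (.fst ℝ _ _) + .snd ℝ _ _
  have hT : (fun x : (Fin n → ℝ) × (Fin p → ℝ) => N *ᵥ x.1 + x.2) = T := rfl
  rw [hT]
  have : IsProbabilityMeasure (((gaussianVec V).prod (gaussianVec V')).map T) :=
    Measure.isProbabilityMeasure_map T.continuous.measurable.aemeasurable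
  refine Measure.ext_of_charFunDual (funext fun l => ?_)
  rw [charFunDual_map, charFunDual_prod, charFunDual_gaussianVec hV, charFunDual_gaussianVec hV',
    charFunDual_gaussianVec ((PosSemidef.congr hV N).add hV'), ← Complex.exp_add]
  have h1 : dualVec ((l.comp T).comp (.inl ℝ _ _)) = Nᵀ *ᵥ dualVec l :=
    dualVec_eq fun x => by
      have : T (x, 0) = N *ᵥ x := by simp [T]
      simp [this, dual_apply, dotProduct_mulVec, mulVec_transpose]
  have h2 : dualVec ((l.comp T).comp (.inr ℝ _ _)) = dualVec l :=
    dualVec_eq fun x => by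
      have : T (0, x) = x := by simp [T]
      simp [this, dual_apply]
  rw [h1, h2, quad_mulVec, transpose_transpose, quad_add_matrix]
  push_cast
  ring_nf

end Gaussian

variable {nx nu ny : ℕ}

namespace Model

/-! ### The Kalman filter in steady state -/

/-- The covariance `f^{t+1}(P̄) - P̄` of the difference between the sensor's estimate and the
controller's prediction when the previous holding time is `t`. -/
def gapCov (m : Model nx nu ny) (t : ℕ) : Matrix (Fin nx) (Fin nx) ℝ :=
  m.f^[t + 1] m.Pbar - m.Pbar

namespace Valid

variable {m : Model nx nu ny}

theorem posDef_f (hm : m.Valid) : (m.f m.Pbar).PosDef :=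
  PosDef.posSemidef_add (PosSemidef.congr hm.hPbar m.A) hm.hQ

theorem posDef_innovation (hm : m.Valid) : (m.C * m.f m.Pbar * m.Cᵀ + m.R).PosDef :=
  PosDef.posSemidef_add (PosSemidef.congr hm.posDef_f.posSemidef m.C) hm.hR

theorem kalmanGain_mul (hm : m.Valid) :
    m.kalmanGain * (m.C * m.f m.Pbar * m.Cᵀ + m.R) = m.f m.Pbar * m.Cᵀ := by
  rw [kalmanGain, Matrix.mul_assoc, Matrix.nonsing_inv_mul _
    ((Matrix.isUnit_iff_isUnit_det _).mp hm.posDef_innovation.isUnit), Matrix.mul_one]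

theorem gain_mul_f (hm : m.Valid) : m.kalmanGain * m.C * m.f m.Pbar = m.gapCov 0 := by
  have h := hm.steady
  rw [Matrix.sub_mul, Matrix.one_mul] at h
  rw [gapCov, zero_add, Function.iterate_one]
  exact eq_sub_of_add_eq (eq_sub_iff_add_eq'.mp h)

theorem gapCov_zero_transpose (hm : m.Valid) : (m.gapCov 0)ᵀ = m.gapCov 0 := by
  rw [gapCov, zero_add, Function.iterate_one, transpose_sub,
    PosSemidef.transpose_eq hm.posDef_f.posSemidef, PosSemidef.transpose_eq hm.hPbar]

theorem gain_innovation_gain (hm : m.Valid) :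
    m.kalmanGain * (m.C * m.f m.Pbar * m.Cᵀ + m.R) * m.kalmanGainᵀ = m.gapCov 0 := by
  rw [hm.kalmanGain_mul, ← hm.gapCov_zero_transpose, ← hm.gain_mul_f]
  simp only [transpose_mul, PosSemidef.transpose_eq hm.posDef_f.posSemidef, Matrix.mul_assoc]

theorem posSemidef_gapCov_zero (hm : m.Valid) : (m.gapCov 0).PosSemidef := by
  rw [← hm.gain_innovation_gain]
  exact PosSemidef.congr hm.posDef_innovation.posSemidef _

end Valid

theorem gapCov_succ (m : Model nx nu ny) (t : ℕ) :
    m.gapCov (t + 1) = m.A * m.gapCov t * m.Aᵀ + m.gapCov 0 := by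
  rw [gapCov, Function.iterate_succ_apply', gapCov, gapCov, zero_add, Function.iterate_one]
  simp only [f, Matrix.mul_sub, Matrix.sub_mul]
  abel

theorem iterate_f_eq (m : Model nx nu ny) (t : ℕ) :
    m.f^[t + 1] m.Pbar = m.gapCov t + m.Pbar := by
  rw [gapCov]; abel

namespace Valid

variable {m : Model nx nu ny}

theorem posSemidef_gapCov (hm : m.Valid) (t : ℕ) : (m.gapCov t).PosSemidef := by
  induction t with
  | zero => exact hm.posSemidef_gapCov_zero
  | succ t ih =>
    rw [gapCov_succ]
    exact (PosSemidef.congr ih m.A).add hm.posSemidef_gapCov_zero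

theorem posSemidef_iterate_f (hm : m.Valid) (t : ℕ) : (m.f^[t] m.Pbar).PosSemidef := by
  cases t with
  | zero => exact hm.hPbar
  | succ t =>
    rw [iterate_f_eq]
    exact (hm.posSemidef_gapCov t).add hm.hPbar

/-- In steady state the correction of the sensor's filter and its new estimation error are
independent, with covariances `f(P̄) - P̄` and `P̄`. -/
theorem map_correction_error (hm : m.Valid) :
    ((gaussianVec m.Pbar).prod ((gaussianVec m.Q).prod (gaussianVec m.R))).map
      (fun x => (m.kalmanGain *ᵥ (m.C *ᵥ (m.A *ᵥ x.1 + x.2.1) + x.2.2),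
        m.A *ᵥ x.1 + x.2.1 - m.kalmanGain *ᵥ (m.C *ᵥ (m.A *ᵥ x.1 + x.2.1) + x.2.2))) =
      (gaussianVec (m.gapCov 0)).prod (gaussianVec m.Pbar) := by
  let T1 : (Fin nx → ℝ) × (Fin nx → ℝ) × (Fin ny → ℝ) →L[ℝ] (Fin nx → ℝ) :=
    (LinearMap.toContinuousLinearMap m.A.mulVecLin).comp (.fst ℝ _ _) +
      (ContinuousLinearMap.fst ℝ _ _).comp (.snd ℝ _ _)
  let T2 : (Fin nx → ℝ) × (Fin nx → ℝ) × (Fin ny → ℝ) →L[ℝ] (Fin nx → ℝ) :=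
    (LinearMap.toContinuousLinearMap m.kalmanGain.mulVecLin).comp
      ((LinearMap.toContinuousLinearMap m.C.mulVecLin).comp T1 +
        (ContinuousLinearMap.snd ℝ _ _).comp (.snd ℝ _ _))
  let T := T2.prod (T1 - T2)
  have hT1 : ∀ e w v, T1 (e, w, v) = m.A *ᵥ e + w := fun e w v => rfl
  have hT2 : ∀ e w v, T2 (e, w, v) = m.kalmanGain *ᵥ (m.C *ᵥ (m.A *ᵥ e + w) + v) :=
    fun e w v => rfl
  have hT : (fun x : (Fin nx → ℝ) × (Fin nx → ℝ) × (Fin ny → ℝ) =>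
      (m.kalmanGain *ᵥ (m.C *ᵥ (m.A *ᵥ x.1 + x.2.1) + x.2.2),
        m.A *ᵥ x.1 + x.2.1 - m.kalmanGain *ᵥ (m.C *ᵥ (m.A *ᵥ x.1 + x.2.1) + x.2.2))) = T := rfl
  rw [hT]
  have : IsProbabilityMeasure (((gaussianVec m.Pbar).prod
      ((gaussianVec m.Q).prod (gaussianVec m.R))).map T) :=
    Measure.isProbabilityMeasure_map T.continuous.measurable.aemeasurable
  refine Measure.ext_of_charFunDual (funext fun l => ?_)
  rw [charFunDual_map]
  simp only [charFunDual_prod, charFunDual_gaussianVec hm.hPbar,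
    charFunDual_gaussianVec hm.hQ.posSemidef, charFunDual_gaussianVec hm.hR.posSemidef,
    charFunDual_gaussianVec hm.posSemidef_gapCov_zero, ← Complex.exp_add]
  set a := dualVec (l.comp (.inl ℝ _ _)) with ha
  set b := dualVec (l.comp (.inr ℝ _ _)) with hb
  have hl : ∀ x y, l (x, y) = a ⬝ᵥ x + b ⬝ᵥ y := by
    intro x y
    rw [ha, hb, ← dual_apply, ← dual_apply]
    simp [← map_add]
  set G := m.kalmanGain * m.C with hG
  set p := Gᵀ *ᵥ (a - b) + b with hp
  have hlT : ∀ e w v, l (T (e, w, v)) = p ⬝ᵥ (m.A *ᵥ e + w) + (m.kalmanGainᵀ *ᵥ (a - b)) ⬝ᵥ v := by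
    intro e w v
    have : T (e, w, v) = (T2 (e, w, v), T1 (e, w, v) - T2 (e, w, v)) := rfl
    rw [this, hl, hT1, hT2, mulVec_add, mulVec_mulVec, ← hG, hp, add_dotProduct,
      mulVec_dotProduct_eq, mulVec_dotProduct_eq, transpose_transpose, transpose_transpose]
    simp only [dotProduct_sub, dotProduct_add, sub_dotProduct]
    ring
  have h1 : dualVec ((l.comp T).comp (.inl ℝ _ _)) = m.Aᵀ *ᵥ p := dualVec_eq fun x => by
    have := hlT x 0 0
    simp only [add_zero, dotProduct_zero] at this
    rw [mulVec_dotProduct_eq, transpose_transpose]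
    exact this
  have h2 : dualVec (((l.comp T).comp (.inr ℝ _ _)).comp (.inl ℝ _ _)) = p :=
    dualVec_eq fun x => by
      have := hlT 0 x 0
      simp only [mulVec_zero, zero_add, add_zero, dotProduct_zero] at this
      exact this
  have h3 : dualVec (((l.comp T).comp (.inr ℝ _ _)).comp (.inr ℝ _ _)) =
      m.kalmanGainᵀ *ᵥ (a - b) := dualVec_eq fun x => by
    have := hlT 0 0 x
    simp only [mulVec_zero, zero_add, add_zero, dotProduct_zero] at this
    exact this
  rw [h1, h2, h3]
  have hsym := hm.gapCov_zero_transpose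
  have hfsym := PosSemidef.transpose_eq hm.posDef_f.posSemidef
  have hf : m.f m.Pbar = m.gapCov 0 + m.Pbar := by
    rw [← iterate_f_eq, zero_add, Function.iterate_one]
  have e1 : quad m.Pbar (m.Aᵀ *ᵥ p) + quad m.Q p = quad (m.f m.Pbar) p := by
    rw [quad_mulVec, transpose_transpose, ← quad_add_matrix]; rfl
  have e2 : quad (m.f m.Pbar) p = quad (G * m.f m.Pbar * Gᵀ) (a - b)
      + 2 * ((a - b) ⬝ᵥ m.gapCov 0 *ᵥ b) + quad (m.f m.Pbar) b := by
    rw [hp, quad_add hfsym, quad_mulVec, transpose_transpose, mulVec_dotProduct_eq,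
      transpose_transpose, mulVec_mulVec, hG, hm.gain_mul_f]
  have e3 : quad (G * m.f m.Pbar * Gᵀ) (a - b) + quad m.R (m.kalmanGainᵀ *ᵥ (a - b)) =
      quad (m.gapCov 0) (a - b) := by
    rw [quad_mulVec, transpose_transpose, ← quad_add_matrix, ← hm.gain_innovation_gain]
    congr 1
    simp only [hG, transpose_mul, Matrix.mul_add, Matrix.add_mul, Matrix.mul_assoc]
  have e4 : quad (m.gapCov 0) a = quad (m.gapCov 0) (a - b)
      + 2 * ((a - b) ⬝ᵥ m.gapCov 0 *ᵥ b) + quad (m.gapCov 0) b := by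
    rw [← quad_add hsym, sub_add_cancel]
  have e5 : quad (m.f m.Pbar) b = quad (m.gapCov 0) b + quad m.Pbar b := by
    rw [hf, quad_add_matrix]
  have key : quad m.Pbar (m.Aᵀ *ᵥ p) + (quad m.Q p + quad m.R (m.kalmanGainᵀ *ᵥ (a - b))) =
      quad (m.gapCov 0) a + quad m.Pbar b := by linarith
  have key' := congrArg (fun r : ℝ => (r : ℂ)) key
  push_cast at key'
  congr 1
  linear_combination (-1 / 2 : ℂ) * key'

/-- Propagating the gap over a stage without reception. -/
theorem map_gap (hm : m.Valid) (t : ℕ) :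
    ((gaussianVec (m.gapCov t)).prod (gaussianVec (m.gapCov 0))).map
      (fun x => m.A *ᵥ x.1 + x.2) = gaussianVec (m.gapCov (t + 1)) := by
  rw [map_add_gaussianVec (hm.posSemidef_gapCov t) (hm.posSemidef_gapCov 0), ← gapCov_succ]

end Valid

/-! ### The Riccati recursion -/

/-- The weight `η Bᵀ S_{k+1} B + U` of the deviation of `u_k` from `-L_k x_k`. -/
def gainWeight (m : Model nx nu ny) (k : ℕ) : Matrix (Fin nu) (Fin nu) ℝ :=
  m.eta • (m.Bᵀ * m.S (k + 1) * m.B) + m.U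

/-- The weight `Lᵀ (η Bᵀ S_{k+1} B + U) L` with which estimation errors enter the cost. -/
def errWeight (m : Model nx nu ny) (k : ℕ) : Matrix (Fin nx) (Fin nx) ℝ :=
  (m.L k)ᵀ * m.gainWeight k * m.L k

namespace Valid

variable {m : Model nx nu ny}

theorem posDef_gainWeight_of (hm : m.Valid) {k : ℕ} (hS : (m.S (k + 1)).PosSemidef) :
    (m.gainWeight k).PosDef :=
  PosDef.posSemidef_add ((PosSemidef.congr_transpose hS m.B).smul hm.eta_pos.le) hm.hU

theorem gainWeight_mul_L_of (hm : m.Valid) {k : ℕ} (hS : (m.S (k + 1)).PosSemidef) :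
    m.gainWeight k * m.L k = m.eta • (m.Bᵀ * m.S (k + 1) * m.A) := by
  have hu : IsUnit (m.gainWeight k).det :=
    (Matrix.isUnit_iff_isUnit_det _).mp (hm.posDef_gainWeight_of hS).isUnit
  rw [L, ← gainWeight, Matrix.mul_smul]
  simp only [← Matrix.mul_assoc, Matrix.mul_nonsing_inv _ hu, Matrix.one_mul]

theorem transpose_L_mul_gainWeight_of (hm : m.Valid) {k : ℕ} (hS : (m.S (k + 1)).PosSemidef) :
    (m.L k)ᵀ * m.gainWeight k = m.eta • (m.Aᵀ * m.S (k + 1) * m.B) := by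
  have h := congrArg transpose (hm.gainWeight_mul_L_of hS)
  simpa [transpose_mul, PosSemidef.transpose_eq (hm.posDef_gainWeight_of hS).posSemidef,
    PosSemidef.transpose_eq hS, Matrix.mul_assoc] using h

theorem errWeight_eq_of (hm : m.Valid) {k : ℕ} (hk : k ≤ m.K) (hS : (m.S (k + 1)).PosSemidef) :
    m.eta • (m.Aᵀ * m.S (k + 1) * m.A) + m.W - m.S k = m.errWeight k := by
  rw [errWeight, hm.transpose_L_mul_gainWeight_of hS, S_step m hk, riccatiMap, L, ← gainWeight]
  simp only [Matrix.smul_mul, Matrix.mul_smul, smul_smul, Matrix.mul_assoc, pow_two]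
  abel

theorem posSemidef_S (hm : m.Valid) {k : ℕ} (hk : k ≤ m.K + 1) : (m.S k).PosSemidef := by
  induction hk using Nat.decreasingInduction with
  | self => rw [S_terminal]; exact hm.hF
  | of_succ k hk ih =>
    have hk' : k ≤ m.K := Nat.lt_succ_iff.mp hk
    have h1 := hm.errWeight_eq_of hk' ih
    have h2 := hm.gainWeight_mul_L_of ih
    have h3 := hm.transpose_L_mul_gainWeight_of ih
    -- the closed-loop (Joseph) form of the recursion
    have h4 : m.S k = m.eta • ((m.A - m.B * m.L k)ᵀ * m.S (k + 1) * (m.A - m.B * m.L k))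
        + m.W + (m.L k)ᵀ * m.U * m.L k := by
      have e1 : m.S k = m.eta • (m.Aᵀ * m.S (k + 1) * m.A) + m.W - m.errWeight k := by
        rw [← h1]; abel
      have e2 : m.eta • (m.Aᵀ * m.S (k + 1) * (m.B * m.L k)) = m.errWeight k := by
        rw [errWeight, h3]
        simp only [Matrix.smul_mul, Matrix.mul_assoc]
      have e3 : m.eta • ((m.B * m.L k)ᵀ * m.S (k + 1) * m.A) = m.errWeight k := by
        rw [errWeight, Matrix.mul_assoc (m.L k)ᵀ, h2]
        simp only [Matrix.mul_smul, Matrix.mul_assoc, transpose_mul]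
      have e4 : m.eta • ((m.B * m.L k)ᵀ * m.S (k + 1) * (m.B * m.L k))
          + (m.L k)ᵀ * m.U * m.L k = m.errWeight k := by
        rw [errWeight, gainWeight]
        simp only [Matrix.mul_add, Matrix.add_mul, Matrix.mul_smul, Matrix.smul_mul,
          Matrix.mul_assoc, transpose_mul]
      rw [e1, transpose_sub]
      simp only [Matrix.mul_sub, Matrix.sub_mul, smul_sub]
      rw [e2, e3, ← e4]
      abel
    rw [h4]
    exact (((PosSemidef.congr_transpose ih _).smul hm.eta_pos.le).add hm.hW).add
      (PosSemidef.congr_transpose hm.hU.posSemidef _)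

theorem posDef_gainWeight (hm : m.Valid) {k : ℕ} (hk : k ≤ m.K) : (m.gainWeight k).PosDef :=
  hm.posDef_gainWeight_of (hm.posSemidef_S (Nat.succ_le_succ hk))

theorem errWeight_eq (hm : m.Valid) {k : ℕ} (hk : k ≤ m.K) :
    m.eta • (m.Aᵀ * m.S (k + 1) * m.A) + m.W - m.S k = m.errWeight k :=
  hm.errWeight_eq_of hk (hm.posSemidef_S (Nat.succ_le_succ hk))

theorem posSemidef_errWeight (hm : m.Valid) {k : ℕ} (hk : k ≤ m.K) :
    (m.errWeight k).PosSemidef :=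
  PosSemidef.congr_transpose (hm.posDef_gainWeight hk).posSemidef _

/-- Completion of the square in one stage. -/
theorem complete_square (hm : m.Valid) {k : ℕ} (hk : k ≤ m.K) (x : Fin nx → ℝ)
    (u : Fin nu → ℝ) :
    m.eta * quad (m.S (k + 1)) (m.A *ᵥ x + m.B *ᵥ u) + (quad m.W x + quad m.U u) =
      quad (m.S k) x + quad (m.gainWeight k) (u + m.L k *ᵥ x) := by
  have hS := hm.posSemidef_S (Nat.succ_le_succ hk)
  have hML := hm.gainWeight_mul_L_of hS
  have h1 : m.S k + m.errWeight k = m.eta • (m.Aᵀ * m.S (k + 1) * m.A) + m.W := by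
    rw [← hm.errWeight_eq hk]; abel
  have hMLx : m.gainWeight k *ᵥ m.L k *ᵥ x =
      (m.eta • (m.Bᵀ * m.S (k + 1) * m.A)) *ᵥ x := by rw [mulVec_mulVec, hML]
  have hcross : (m.A *ᵥ x) ⬝ᵥ m.S (k + 1) *ᵥ m.B *ᵥ u =
      u ⬝ᵥ (m.Bᵀ * m.S (k + 1) * m.A) *ᵥ x := by
    rw [dotProduct_mulVec_comm (PosSemidef.transpose_eq hS), mulVec_dotProduct_eq, mulVec_mulVec,
      mulVec_mulVec]
  have h2 := congrArg (fun N => quad N x) h1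
  simp only [quad_add_matrix, quad_smul_matrix] at h2
  rw [quad_add (PosSemidef.transpose_eq hS),
    quad_add (PosSemidef.transpose_eq (hm.posDef_gainWeight hk).posSemidef),
    hMLx, hcross, quad_mulVec, quad_mulVec, quad_mulVec _ (m.L k), ← errWeight,
    gainWeight, quad_add_matrix, quad_smul_matrix, smul_mulVec, dotProduct_smul, smul_eq_mul]
  linarith

/-- Completion of the square, averaged over the process noise. -/
theorem lintegral_next (hm : m.Valid) {k : ℕ} (hk : k ≤ m.K) (x : Fin nx → ℝ) (u : Fin nu → ℝ) :
    ∫⁻ w, ENNReal.ofReal (m.eta * quad (m.S (k + 1)) (m.A *ᵥ x + m.B *ᵥ u + w))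
        ∂(gaussianVec m.Q) + ENNReal.ofReal (quad m.W x + quad m.U u) =
      ENNReal.ofReal (quad (m.S k) x) + ENNReal.ofReal (quad (m.gainWeight k) (u + m.L k *ᵥ x))
        + ENNReal.ofReal (m.eta * trace (m.S (k + 1) * m.Q)) := by
  have hS := hm.posSemidef_S (Nat.succ_le_succ hk)
  have hη := hm.eta_pos.le
  have h := lintegral_quad_add_gaussianVec hS hm.hQ.posSemidef 1 (m.A *ᵥ x + m.B *ᵥ u)
  simp only [one_mulVec, transpose_one, Matrix.one_mul, Matrix.mul_one] at h
  simp only [ENNReal.ofReal_mul hη]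
  rw [lintegral_const_mul' _ _ ENNReal.ofReal_ne_top, h, ← ENNReal.ofReal_mul hη,
    ← ENNReal.ofReal_mul hη]
  have p1 := quad_nonneg hS (m.A *ᵥ x + m.B *ᵥ u)
  have p2 := trace_mul_nonneg hS hm.hQ.posSemidef
  have p3 := quad_nonneg hm.hW x
  have p4 := quad_nonneg hm.hU.posSemidef u
  have p5 := quad_nonneg (hm.posSemidef_S (Nat.le_succ_of_le hk)) x
  have p6 := quad_nonneg (hm.posDef_gainWeight hk).posSemidef (u + m.L k *ᵥ x)
  rw [← ENNReal.ofReal_add (by positivity) (by positivity),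
    ← ENNReal.ofReal_add (by positivity) (by positivity),
    ← ENNReal.ofReal_add (by positivity) (by positivity), ← hm.complete_square hk]
  congr 1
  ring

end Valid

end Model

/-! ### The closed loop as a chain driven by the stage noises -/

@[fun_prop]
theorem measurable_mulVec_comp {α : Type*} [MeasurableSpace α] {n p : ℕ}
    (N : Matrix (Fin p) (Fin n) ℝ) {g : α → Fin n → ℝ} (hg : Measurable g) :
    Measurable fun a => N *ᵥ g a :=
  (Continuous.matrix_mulVec continuous_const continuous_id).measurable.comp hg

theorem measurable_quad_comp {α : Type*} [MeasurableSpace α] {n : ℕ}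
    (S : Matrix (Fin n) (Fin n) ℝ) {g : α → Fin n → ℝ} (hg : Measurable g) :
    Measurable fun a => quad S (g a) :=
  (continuous_quad S).measurable.comp hg

theorem measurable_decide_lt {α β : Type*} [MeasurableSpace α] [MeasurableSpace β]
    [TopologicalSpace β] [OpensMeasurableSpace β] [LinearOrder β] [OrderClosedTopology β]
    [SecondCountableTopology β] {g h : α → β} (hg : Measurable g) (hh : Measurable h) :
    Measurable fun a => decide (g a < h a) := by
  refine measurable_to_bool ?_
  have : (fun a => decide (g a < h a)) ⁻¹' {true} = {a | g a < h a} := by ext; simp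
  rw [this]
  exact measurableSet_lt hg hh

theorem measurable_and {α : Type*} [MeasurableSpace α] {g h : α → Bool} (hg : Measurable g)
    (hh : Measurable h) : Measurable fun a => g a && h a :=
  (measurable_of_finite fun p : Bool × Bool => p.1 && p.2).comp (hg.prodMk hh)

/-- The seeds of one stage, for `ν_k`, `u_k`, `a_k` and the channel. -/
abbrev Seeds : Type := unitInterval × unitInterval × unitInterval × unitInterval

/-- The law of the seeds of one stage. -/
abbrev seedLaw : Measure Seeds := (volume : Measure unitInterval).prod
  ((volume : Measure unitInterval).prod
    ((volume : Measure unitInterval).prod (volume : Measure unitInterval)))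

/-- The controller's information, together with the gap `x̂ˢ_k - x̄_k` between the sensor's
estimate and the controller's prediction and the sensor's error `x_k - x̂ˢ_k`. -/
abbrev LoopState (nx nu k : ℕ) : Type := Info nx nu k × (Fin nx → ℝ) × (Fin nx → ℝ)

/-- The acknowledgments `γ₀, …, γ_{k-1}` contained in the controller's information. -/
def acks {k : ℕ} (I : Info nx nu k) : Fin k → Bool := fun i => (I.2 i).2.1

theorem measurable_acks {k : ℕ} : Measurable (acks : Info nx nu k → Fin k → Bool) := by
  unfold acks
  fun_prop

/-- The scheduling command as a function of the information and the seeds. -/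
def drawSched (pol : ControllerPolicy nx nu) (k : ℕ) (I : Info nx nu k) (s : Seeds) : Bool :=
  decide (s.1 < pol.sched k I)

/-- The attack decision as a function of the acknowledgments and the seeds. -/
def drawAttack (α : AttackPolicy) (k : ℕ) (g : Fin k → Bool) (s : Seeds) : Bool :=
  decide (s.2.2.1 < α k g)

namespace Model

/-- The law of the randomness of one stage. -/
abbrev stageLaw (m : Model nx nu ny) : Measure (StageNoise nx ny) :=
  (gaussianVec m.Q).prod ((gaussianVec m.R).prod seedLaw)

/-- The arrival indicator as a function of the information and the seeds. -/
def drawArrival (m : Model nx nu ny) (pol : ControllerPolicy nx nu) (α : AttackPolicy) (k : ℕ)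
    (I : Info nx nu k) (s : Seeds) : Bool :=
  drawSched pol k I s && decide ((s.2.2.2 : ℝ) < m.succProb (drawAttack α k (acks I) s))

/-- The observation as a function of the information, the gap and the seeds. An arrival requires
`ν_k = 1`, so the arrival indicator alone decides whether the sensor's estimate is seen. -/
def drawObs (m : Model nx nu ny) (pol : ControllerPolicy nx nu) (α : AttackPolicy) (k : ℕ)
    (I : Info nx nu k) (d : Fin nx → ℝ) (s : Seeds) : Bool × Bool × (Fin nx → ℝ) :=
  (drawSched pol k I s, m.drawArrival pol α k I s,
    if m.drawArrival pol α k I s then m.predEstimate k I + d else 0)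

/-- The input as a function of the information, the gap and the seeds. -/
def drawInput (m : Model nx nu ny) (pol : ControllerPolicy nx nu) (α : AttackPolicy) (k : ℕ)
    (I : Info nx nu k) (d : Fin nx → ℝ) (s : Seeds) : Fin nu → ℝ :=
  pol.input k I (m.drawObs pol α k I d s) s.2.1

/-- The information at the next stage. -/
def nextInfo (m : Model nx nu ny) (pol : ControllerPolicy nx nu) (α : AttackPolicy) (k : ℕ)
    (I : Info nx nu k) (d : Fin nx → ℝ) (s : Seeds) : Info nx nu (k + 1) :=
  (I.1, Fin.snoc (α := fun _ => Rec nx nu) I.2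
    ((m.drawObs pol α k I d s).1, (m.drawObs pol α k I d s).2.1, (m.drawObs pol α k I d s).2.2,
      m.drawInput pol α k I d s))

/-- The correction of the sensor's filter, and the sensor's new error, in terms of the old error,
the process noise and the measurement noise. -/
def correctionError (m : Model nx nu ny) (x : (Fin nx → ℝ) × (Fin nx → ℝ) × (Fin ny → ℝ)) :
    (Fin nx → ℝ) × (Fin nx → ℝ) :=
  (m.kalmanGain *ᵥ (m.C *ᵥ (m.A *ᵥ x.1 + x.2.1) + x.2.2),
    m.A *ᵥ x.1 + x.2.1 - m.kalmanGain *ᵥ (m.C *ᵥ (m.A *ᵥ x.1 + x.2.1) + x.2.2))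

/-- The gap that remains once the packet of the current stage has or has not arrived. -/
def residualGap (m : Model nx nu ny) (pol : ControllerPolicy nx nu) (α : AttackPolicy) (k : ℕ)
    (I : Info nx nu k) (d : Fin nx → ℝ) (s : Seeds) : Fin nx → ℝ :=
  if m.drawArrival pol α k I s then 0 else d

/-- One step of the closed loop. -/
def stepState (m : Model nx nu ny) (pol : ControllerPolicy nx nu) (α : AttackPolicy) (k : ℕ)
    (y : LoopState nx nu k) (z : StageNoise nx ny) : LoopState nx nu (k + 1) :=
  (m.nextInfo pol α k y.1 y.2.1 z.2.2,
    m.A *ᵥ m.residualGap pol α k y.1 y.2.1 z.2.2 + (m.correctionError (y.2.2, z.1, z.2.1)).1,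
    (m.correctionError (y.2.2, z.1, z.2.1)).2)

/-- The state of the closed loop before the decisions of time `k`. -/
def loopState (m : Model nx nu ny) (pol : ControllerPolicy nx nu) (α : AttackPolicy) (k : ℕ)
    (ω : Sample nx ny) : LoopState nx nu k :=
  ((m.run pol α ω k).info ω,
    (m.run pol α ω k).xs - m.predEstimate k ((m.run pol α ω k).info ω),
    (m.run pol α ω k).x - (m.run pol α ω k).xs)

section Run

variable (m : Model nx nu ny) (pol : ControllerPolicy nx nu) (α : AttackPolicy) (k : ℕ)
  (ω : Sample nx ny)

theorem run_xs_eq : (m.run pol α ω k).xs =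
    m.predEstimate k (m.loopState pol α k ω).1 + (m.loopState pol α k ω).2.1 := by
  simp [loopState]

theorem run_x_eq : (m.run pol α ω k).x = m.predEstimate k (m.loopState pol α k ω).1 +
    (m.loopState pol α k ω).2.1 + (m.loopState pol α k ω).2.2 := by
  simp [loopState]

theorem run_sched_eq : (m.run pol α ω k).sched pol ω =
    drawSched pol k (m.loopState pol α k ω).1 (ω.2 k).2.2 := rfl

theorem run_attack_eq : (m.run pol α ω k).attack α ω =
    drawAttack α k (acks (m.loopState pol α k ω).1) (ω.2 k).2.2 := rfl

theorem run_arrival_eq : (m.run pol α ω k).arrival m pol α ω =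
    m.drawArrival pol α k (m.loopState pol α k ω).1 (ω.2 k).2.2 := rfl

theorem drawSched_and_drawArrival (I : Info nx nu k) (s : Seeds) :
    (drawSched pol k I s && m.drawArrival pol α k I s) = m.drawArrival pol α k I s := by
  simp [drawArrival]

theorem run_obs_eq : (m.run pol α ω k).obs m pol α ω = m.drawObs pol α k
    (m.loopState pol α k ω).1 (m.loopState pol α k ω).2.1 (ω.2 k).2.2 := by
  simp only [Config.obs, drawObs, run_sched_eq, run_arrival_eq, run_xs_eq,
    drawSched_and_drawArrival]

theorem inputAt_eq : m.inputAt pol α k ω = m.drawInput pol α k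
    (m.loopState pol α k ω).1 (m.loopState pol α k ω).2.1 (ω.2 k).2.2 := by
  simp only [inputAt, Config.input, run_obs_eq, drawInput]
  rfl

theorem estimate_drawObs (I : Info nx nu k) (d : Fin nx → ℝ) (s : Seeds) :
    m.estimate k I (m.drawObs pol α k I d s) =
      m.predEstimate k I + d - m.residualGap pol α k I d s := by
  simp only [estimate, drawObs, drawSched_and_drawArrival, residualGap]
  split_ifs <;> simp

theorem estimateAt_eq : m.estimateAt pol α k ω =
    m.predEstimate k (m.loopState pol α k ω).1 + (m.loopState pol α k ω).2.1 -
      m.residualGap pol α k (m.loopState pol α k ω).1 (m.loopState pol α k ω).2.1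
        (ω.2 k).2.2 := by
  rw [estimateAt, run_obs_eq, ← estimate_drawObs]
  rfl

theorem predEstimate_nextInfo (I : Info nx nu k) (d : Fin nx → ℝ) (s : Seeds) :
    m.predEstimate (k + 1) (m.nextInfo pol α k I d s) =
      m.A *ᵥ (m.predEstimate k I + d - m.residualGap pol α k I d s)
        + m.B *ᵥ m.drawInput pol α k I d s := by
  rw [← estimate_drawObs]
  simp [predEstimate, nextInfo, estimate]

theorem run_next_info : (m.run pol α ω (k + 1)).info ω = m.nextInfo pol α k
    (m.loopState pol α k ω).1 (m.loopState pol α k ω).2.1 (ω.2 k).2.2 := by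
  simp only [nextInfo, ← run_obs_eq, ← inputAt_eq]
  rfl

theorem run_next_x : (m.run pol α ω (k + 1)).x =
    m.A *ᵥ (m.run pol α ω k).x + m.B *ᵥ m.inputAt pol α k ω + (ω.2 k).1 := rfl

theorem loopState_zero : m.loopState pol α 0 ω = ((ω.1.1, Fin.elim0), ω.1.2) := by
  refine Prod.ext rfl (Prod.ext ?_ ?_)
  · exact add_sub_cancel_left ω.1.1 ω.1.2.1
  · exact add_sub_cancel_left (ω.1.1 + ω.1.2.1) ω.1.2.2

theorem loopState_succ : m.loopState pol α (k + 1) ω =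
    m.stepState pol α k (m.loopState pol α k ω) (ω.2 k) := by
  have hx : (m.run pol α ω (k + 1)).x = m.A *ᵥ (m.run pol α ω k).x +
      m.B *ᵥ m.inputAt pol α k ω + (ω.2 k).1 := rfl
  have hxs : (m.run pol α ω (k + 1)).xs = m.A *ᵥ (m.run pol α ω k).xs
      + m.B *ᵥ m.inputAt pol α k ω + m.kalmanGain *ᵥ (m.C *ᵥ (m.run pol α ω (k + 1)).x
        + (ω.2 k).2.1 - m.C *ᵥ (m.A *ᵥ (m.run pol α ω k).xs
          + m.B *ᵥ m.inputAt pol α k ω)) := rfl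
  have h1 : m.C *ᵥ (m.run pol α ω (k + 1)).x + (ω.2 k).2.1 - m.C *ᵥ (m.A *ᵥ (m.run pol α ω k).xs
      + m.B *ᵥ m.inputAt pol α k ω) =
      m.C *ᵥ (m.A *ᵥ (m.loopState pol α k ω).2.2 + (ω.2 k).1) + (ω.2 k).2.1 := by
    rw [hx, run_x_eq, run_xs_eq]
    simp only [mulVec_add]
    abel
  rw [loopState, run_next_info, predEstimate_nextInfo, hxs, h1, hx, stepState, correctionError,
    run_x_eq, run_xs_eq, inputAt_eq]
  refine Prod.ext rfl (Prod.ext ?_ ?_)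
  · simp only [mulVec_add, mulVec_sub]
    abel
  · simp only [mulVec_add]
    abel

end Run

section Measurability

variable (m : Model nx nu ny) (pol : ControllerPolicy nx nu) (α : AttackPolicy) (k : ℕ)

@[fun_prop]
theorem measurable_predEstimate_comp {β : Type*} [MeasurableSpace β] {g : β → Info nx nu k}
    (hg : Measurable g) : Measurable fun b => m.predEstimate k (g b) :=
  (m.measurable_predEstimate k).comp hg

theorem measurable_drawSched :
    Measurable fun p : Info nx nu k × Seeds => drawSched pol k p.1 p.2 :=
  measurable_decide_lt (by fun_prop) ((pol.measurable_sched k).comp measurable_fst)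

theorem measurable_drawAttack :
    Measurable fun p : Info nx nu k × Seeds => drawAttack α k (acks p.1) p.2 :=
  measurable_decide_lt (by fun_prop)
    ((measurable_of_finite (α k)).comp (measurable_acks.comp measurable_fst))

theorem measurable_drawArrival :
    Measurable fun p : Info nx nu k × Seeds => m.drawArrival pol α k p.1 p.2 :=
  measurable_and (measurable_drawSched pol k) (measurable_decide_lt (by fun_prop)
    ((measurable_of_finite m.succProb).comp (measurable_drawAttack α k)))

theorem measurableSet_drawArrival :
    MeasurableSet {p : Info nx nu k × (Fin nx → ℝ) × Seeds |
      m.drawArrival pol α k p.1 p.2.2 = true} :=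
  ((m.measurable_drawArrival pol α k).comp
    (by fun_prop : Measurable fun p : Info nx nu k × (Fin nx → ℝ) × Seeds => (p.1, p.2.2)))
    (measurableSet_singleton true)

theorem measurable_drawObs : Measurable fun p : Info nx nu k × (Fin nx → ℝ) × Seeds =>
    m.drawObs pol α k p.1 p.2.1 p.2.2 := by
  have h : Measurable fun p : Info nx nu k × (Fin nx → ℝ) × Seeds => (p.1, p.2.2) := by fun_prop
  refine ((measurable_drawSched pol k).comp h).prodMk
    (((m.measurable_drawArrival pol α k).comp h).prodMk ?_)
  exact Measurable.ite (m.measurableSet_drawArrival pol α k) (by fun_prop) measurable_const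

theorem measurable_residualGap : Measurable fun p : Info nx nu k × (Fin nx → ℝ) × Seeds =>
    m.residualGap pol α k p.1 p.2.1 p.2.2 :=
  Measurable.ite (m.measurableSet_drawArrival pol α k) measurable_const (by fun_prop)

theorem measurable_drawInput : Measurable fun p : Info nx nu k × (Fin nx → ℝ) × Seeds =>
    m.drawInput pol α k p.1 p.2.1 p.2.2 :=
  (pol.measurable_input k).comp (measurable_fst.prodMk
    ((m.measurable_drawObs pol α k).prodMk (by fun_prop)))

theorem measurable_nextInfo : Measurable fun p : Info nx nu k × (Fin nx → ℝ) × Seeds =>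
    m.nextInfo pol α k p.1 p.2.1 p.2.2 := by
  refine (by fun_prop : Measurable _).prodMk (measurable_pi_lambda _ fun i => ?_)
  have hO := m.measurable_drawObs pol α k
  have hU := m.measurable_drawInput pol α k
  refine Fin.lastCases ?_ (fun j => ?_) i
  · simp only [Fin.snoc_last]
    exact hO.fst.prodMk (hO.snd.fst.prodMk (hO.snd.snd.prodMk hU))
  · simp only [Fin.snoc_castSucc]
    fun_prop

theorem measurable_correctionError : Measurable m.correctionError := by
  unfold correctionError
  fun_prop

theorem measurable_stepState : Measurable fun p : LoopState nx nu k × StageNoise nx ny =>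
    m.stepState pol α k p.1 p.2 := by
  have h1 := m.measurable_nextInfo pol α k
  have h2 := m.measurable_residualGap pol α k
  have h3 := m.measurable_correctionError
  unfold stepState
  have h : Measurable fun p : LoopState nx nu k × StageNoise nx ny =>
      (p.1.1, p.1.2.1, p.2.2.2) := by
    fun_prop
  have h' : Measurable fun p : LoopState nx nu k × StageNoise nx ny =>
      m.correctionError (p.1.2.2, p.2.1, p.2.2.1) := h3.comp (by fun_prop)
  exact (h1.comp h).prodMk (((measurable_mulVec_comp _ (h2.comp h)).add h'.fst).prodMk h'.snd)

theorem measurable_loopState : Measurable (m.loopState pol α k : Sample nx ny → _) := by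
  induction k with
  | zero =>
    rw [funext (m.loopState_zero pol α)]
    fun_prop
  | succ k ih =>
    rw [funext (m.loopState_succ pol α k)]
    exact (m.measurable_stepState pol α k).comp (ih.prodMk (by fun_prop))

theorem measurable_loopState_seeds : Measurable fun ω : Sample nx ny =>
    ((m.loopState pol α k ω).1, (m.loopState pol α k ω).2.1, (ω.2 k).2.2) := by
  have h := m.measurable_loopState pol α k
  exact h.fst.prodMk (h.snd.fst.prodMk (by fun_prop))

end Measurability

-- From here on only the recursion of the loop state matters; unfolding it is expensive.
attribute [irreducible] loopState

end Model

/-! ### Independence of the stages -/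

theorem measurable_update_prod {X : Type*} [MeasurableSpace X] (k : ℕ) :
    Measurable fun p : (ℕ → X) × X => Function.update p.1 k p.2 := by
  refine measurable_pi_lambda _ fun i => ?_
  by_cases h : i = k
  · subst h; simpa using measurable_snd
  · simpa [Function.update_of_ne h] using
      (by fun_prop : Measurable fun p : (ℕ → X) × X => p.1 i)

theorem lintegral_prod_fst {X Y : Type*} [MeasurableSpace X] [MeasurableSpace Y] (μ : Measure X)
    (ν : Measure Y) [IsProbabilityMeasure ν] {g : X → ENNReal} (hg : Measurable g) :
    ∫⁻ p, g p.1 ∂(μ.prod ν) = ∫⁻ x, g x ∂μ := by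
  refine (lintegral_prod _ (by fun_prop)).trans ?_
  simp

theorem lintegral_prod_snd {X Y : Type*} [MeasurableSpace X] [MeasurableSpace Y] (μ : Measure X)
    [IsProbabilityMeasure μ] (ν : Measure Y) [SFinite ν] {g : Y → ENNReal} (hg : Measurable g) :
    ∫⁻ p, g p.2 ∂(μ.prod ν) = ∫⁻ y, g y ∂ν := by
  refine (lintegral_prod _ (by fun_prop)).trans ?_
  simp

/-- Replacing one coordinate of an infinite product by an independent copy does not change its
law. -/
theorem map_update_infinitePi {X : Type*} [MeasurableSpace X] (μ : Measure X)
    [IsProbabilityMeasure μ] (k : ℕ) :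
    ((Measure.infinitePi fun _ : ℕ => μ).prod μ).map (fun p => Function.update p.1 k p.2) =
      Measure.infinitePi fun _ : ℕ => μ := by
  have hmeas := measurable_update_prod (X := X) k
  refine Measure.eq_infinitePi _ fun s t ht => ?_
  rw [Measure.map_apply hmeas (MeasurableSet.pi s.countable_toSet fun i _ => ht i)]
  have hpre : (fun p : (ℕ → X) × X => Function.update p.1 k p.2) ⁻¹' (Set.pi s t) =
      (Set.pi (s.erase k : Finset ℕ) t) ×ˢ (if k ∈ s then t k else Set.univ) := by
    ext ⟨a, z⟩
    simp only [Set.mem_preimage, Set.mem_pi, Finset.mem_coe, Set.mem_prod, Finset.mem_erase]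
    constructor
    · intro h
      refine ⟨fun i hi => by simpa [Function.update_of_ne hi.1] using h i hi.2, ?_⟩
      split_ifs with hk
      · simpa using h k hk
      · trivial
    · rintro ⟨h1, h2⟩ i hi
      by_cases hik : i = k
      · subst hik
        rw [if_pos hi] at h2
        simpa using h2
      · simpa [Function.update_of_ne hik] using h1 i ⟨hik, hi⟩
  rw [hpre, Measure.prod_prod, Measure.infinitePi_pi _ fun i _ => ht i]
  split_ifs with hk
  · rw [mul_comm, Finset.mul_prod_erase s (fun i => μ (t i)) hk]
  · rw [measure_univ, mul_one, Finset.erase_eq_of_notMem hk]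

namespace Model

instance (m : Model nx nu ny) : IsProbabilityMeasure m.law := by
  unfold law
  infer_instance

/-- The randomness of stage `k` may be resampled. -/
theorem lintegral_law_resample (m : Model nx nu ny) (k : ℕ) {Φ : Sample nx ny → ENNReal}
    (hΦ : Measurable Φ) :
    ∫⁻ ω, Φ ω ∂m.law =
      ∫⁻ ω, ∫⁻ z, Φ (ω.1, Function.update ω.2 k z) ∂m.stageLaw ∂m.law := by
  have hup := measurable_update_prod (X := StageNoise nx ny) k
  have hΨ : Measurable fun p : Sample nx ny × StageNoise nx ny =>
      Φ (p.1.1, Function.update p.1.2 k p.2) :=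
    hΦ.comp (measurable_fst.fst.prodMk (hup.comp (measurable_fst.snd.prodMk measurable_snd)))
  unfold law
  rw [lintegral_prod _ hΦ.aemeasurable, lintegral_prod _ hΨ.lintegral_prod_right'.aemeasurable]
  refine lintegral_congr fun a => ?_
  have hΦa : Measurable fun b => Φ (a, b) := hΦ.comp measurable_prodMk_left
  conv_lhs => rw [← map_update_infinitePi _ k, lintegral_map hΦa hup]
  exact lintegral_prod _ (hΦa.comp hup).aemeasurable

theorem loopState_update (m : Model nx nu ny) (pol : ControllerPolicy nx nu) (α : AttackPolicy)
    {j k : ℕ} (hjk : j ≤ k) (ω : Sample nx ny) (z : StageNoise nx ny) :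
    m.loopState pol α j (ω.1, Function.update ω.2 k z) = m.loopState pol α j ω := by
  induction j with
  | zero => rw [loopState_zero, loopState_zero]
  | succ j ih =>
    rw [loopState_succ, loopState_succ, ih (Nat.le_of_succ_le hjk)]
    simp only [Function.update_of_ne (Nat.ne_of_lt hjk)]

/-- The randomness of stage `k` is independent of the state of the loop before stage `k`. -/
theorem lintegral_loopState_stage (m : Model nx nu ny) (pol : ControllerPolicy nx nu)
    (α : AttackPolicy) (k : ℕ) {Φ : LoopState nx nu k × StageNoise nx ny → ENNReal}
    (hΦ : Measurable Φ) :
    ∫⁻ ω, Φ (m.loopState pol α k ω, ω.2 k) ∂m.law =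
      ∫⁻ ω, ∫⁻ z, Φ (m.loopState pol α k ω, z) ∂m.stageLaw ∂m.law := by
  have h := m.lintegral_law_resample k (Φ := fun ω => Φ (m.loopState pol α k ω, ω.2 k))
    (hΦ.comp ((m.measurable_loopState pol α k).prodMk (by fun_prop)))
  rw [h]
  simp only [loopState_update m pol α le_rfl, Function.update_self]

/-! ### The conditional law of the estimation errors -/

/-- The conditional law of the gap and of the sensor's error, given that the holding time
before the current stage is `t`. -/
def errLaw (m : Model nx nu ny) (t : ℕ) : Measure ((Fin nx → ℝ) × (Fin nx → ℝ)) :=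
  (gaussianVec (m.gapCov t)).prod (gaussianVec m.Pbar)

instance (m : Model nx nu ny) (t : ℕ) : IsProbabilityMeasure (m.errLaw t) := by
  unfold errLaw
  infer_instance

/-- The holding time as a function of the controller's information. -/
def hold (m : Model nx nu ny) {k : ℕ} (I : Info nx nu k) : ℕ := holdingTime m.t0 k (acks I)

theorem measurable_hold (m : Model nx nu ny) {k : ℕ} :
    Measurable (m.hold : Info nx nu k → ℕ) :=
  (measurable_of_finite (holdingTime m.t0 k)).comp measurable_acks

/-- The average of a function of the loop state over the estimation errors, as a function of the
controller's information. -/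
def errAvg (m : Model nx nu ny) {k : ℕ} (φ : LoopState nx nu k → ENNReal) (I : Info nx nu k) :
    ENNReal :=
  ∫⁻ y, φ (I, y) ∂m.errLaw (m.hold I)

theorem measurable_errAvg (m : Model nx nu ny) {k : ℕ} {φ : LoopState nx nu k → ENNReal}
    (hφ : Measurable φ) : Measurable (m.errAvg φ) := by
  have ht : ∀ t, Measurable fun I : Info nx nu k => ∫⁻ y, φ (I, y) ∂m.errLaw t :=
    fun t => hφ.lintegral_prod_right'
  have h : Measurable fun p : ℕ × Info nx nu k => ∫⁻ y, φ (p.2, y) ∂m.errLaw p.1 := by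
    apply measurable_from_prod_countable_right
    exact ht
  have h2 : Measurable fun I : Info nx nu k => (m.hold I, I) :=
    m.measurable_hold.prodMk measurable_id
  have h3 := h.comp h2
  exact h3

section NextInfo

variable (m : Model nx nu ny) (pol : ControllerPolicy nx nu) (α : AttackPolicy) (k : ℕ)
  (I : Info nx nu k) (d : Fin nx → ℝ) (s : Seeds)

theorem acks_nextInfo : acks (m.nextInfo pol α k I d s) =
    Fin.snoc (α := fun _ => Bool) (acks I) (m.drawArrival pol α k I s) := by
  funext i
  refine Fin.lastCases ?_ (fun j => ?_) i
  · simp [acks, nextInfo, drawObs]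
  · simp [acks, nextInfo]

theorem holdingTime_snoc (t0 : ℕ) {k : ℕ} (g : Fin k → Bool) (b : Bool) :
    holdingTime t0 (k + 1) (Fin.snoc (α := fun _ => Bool) g b) =
      if b then 0 else holdingTime t0 k g + 1 := by
  simp [holdingTime]

theorem hold_nextInfo : m.hold (m.nextInfo pol α k I d s) =
    if m.drawArrival pol α k I s then 0 else m.hold I + 1 := by
  rw [hold, acks_nextInfo, holdingTime_snoc, hold]

theorem nextInfo_of_not_arrival (h : m.drawArrival pol α k I s = false) :
    m.nextInfo pol α k I d s = m.nextInfo pol α k I 0 s := by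
  simp only [nextInfo, drawInput, drawObs, h]
  rfl

end NextInfo

/-- Averaging over one stage: the sensor's correction and its new error may be replaced by
independent Gaussian vectors, and the seeds drawn first. -/
theorem lintegral_errLaw_stage {m : Model nx nu ny} (hm : m.Valid) (t : ℕ)
    {g : Seeds × (Fin nx → ℝ) × (Fin nx → ℝ) × (Fin nx → ℝ) → ENNReal} (hg : Measurable g) :
    ∫⁻ y, ∫⁻ z, g (z.2.2, y.1, m.correctionError (y.2, z.1, z.2.1)) ∂m.stageLaw ∂m.errLaw t =
      ∫⁻ s, ∫⁻ d, ∫⁻ y, g (s, d, y) ∂m.errLaw 0 ∂gaussianVec (m.gapCov t) ∂seedLaw := by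
  have hc := m.measurable_correctionError
  have h1 : ∀ s d, ∫⁻ y, g (s, d, y) ∂m.errLaw 0 =
      ∫⁻ x, g (s, d, m.correctionError x) ∂((gaussianVec m.Pbar).prod
        ((gaussianVec m.Q).prod (gaussianVec m.R))) := by
    intro s d
    rw [errLaw, ← hm.map_correction_error]
    exact lintegral_map (hg.comp (by fun_prop)) hc
  simp only [h1]
  have hG : Measurable fun p : (Seeds × (Fin nx → ℝ)) × (Fin nx → ℝ) × (Fin nx → ℝ) ×
      (Fin ny → ℝ) => g (p.1.1, p.1.2, m.correctionError p.2) :=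
    hg.comp (measurable_fst.fst.prodMk (measurable_fst.snd.prodMk (hc.comp measurable_snd)))
  refine Eq.trans ?_ (lintegral_lintegral_swap hG.lintegral_prod_right'.aemeasurable).symm
  have hL : Measurable fun p : ((Fin nx → ℝ) × (Fin nx → ℝ)) × StageNoise nx ny =>
      g (p.2.2.2, p.1.1, m.correctionError (p.1.2, p.2.1, p.2.2.1)) :=
    hg.comp (by fun_prop)
  rw [errLaw, lintegral_prod _ hL.lintegral_prod_right'.aemeasurable]
  refine lintegral_congr fun d => ?_
  have hG' : Measurable fun p : Seeds × (Fin nx → ℝ) × (Fin nx → ℝ) × (Fin ny → ℝ) =>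
      g (p.1, d, m.correctionError p.2) := hg.comp (by fun_prop)
  refine Eq.trans ?_ (lintegral_lintegral_swap hG'.aemeasurable).symm
  rw [lintegral_prod _ hG'.lintegral_prod_left'.aemeasurable]
  refine lintegral_congr fun e => ?_
  have hG'' : Measurable fun p : Seeds × (Fin nx → ℝ) × (Fin ny → ℝ) =>
      g (p.1, d, m.correctionError (e, p.2)) := hg.comp (by fun_prop)
  have hL' : Measurable fun z : StageNoise nx ny =>
      g (z.2.2, d, m.correctionError (e, z.1, z.2.1)) := hg.comp (by fun_prop)
  rw [lintegral_prod _ hG''.lintegral_prod_left'.aemeasurable,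
    lintegral_prod _ hL'.aemeasurable]
  refine lintegral_congr fun w => ?_
  exact lintegral_prod _ (hL'.comp measurable_prodMk_left).aemeasurable

/-- Propagation of the conditional law over one stage, for fixed information and seeds. -/
theorem lintegral_step_errors {m : Model nx nu ny} (hm : m.Valid) (pol : ControllerPolicy nx nu)
    (α : AttackPolicy) (k : ℕ) (I : Info nx nu k) (s : Seeds)
    {φ : LoopState nx nu (k + 1) → ENNReal} (hφ : Measurable φ) :
    ∫⁻ d, ∫⁻ y, φ (m.nextInfo pol α k I d s, m.A *ᵥ m.residualGap pol α k I d s + y.1, y.2)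
        ∂m.errLaw 0 ∂gaussianVec (m.gapCov (m.hold I)) =
      ∫⁻ d, m.errAvg φ (m.nextInfo pol α k I d s) ∂gaussianVec (m.gapCov (m.hold I)) := by
  cases h : m.drawArrival pol α k I s with
  | true =>
    refine lintegral_congr fun d => ?_
    simp [errAvg, hold_nextInfo, h, residualGap]
  | false =>
    simp only [nextInfo_of_not_arrival m pol α k I _ s h, residualGap, h]
    rw [lintegral_const, measure_univ, mul_one, errAvg, hold_nextInfo, h]
    set I' := m.nextInfo pol α k I 0 s
    have h0 : Measurable fun p : (Fin nx → ℝ) × (Fin nx → ℝ) × (Fin nx → ℝ) =>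
        φ (I', m.A *ᵥ p.1 + p.2.1, p.2.2) := hφ.comp (by fun_prop)
    have h1 : ∀ d, ∫⁻ y, φ (I', m.A *ᵥ d + y.1, y.2) ∂m.errLaw 0 =
        ∫⁻ c, ∫⁻ e, φ (I', m.A *ᵥ d + c, e) ∂gaussianVec m.Pbar ∂gaussianVec (m.gapCov 0) :=
      fun d => lintegral_prod _ (h0.comp (measurable_prodMk_left (x := d))).aemeasurable
    have h2 : Measurable fun p : (Fin nx → ℝ) × (Fin nx → ℝ) => φ (I', p.1, p.2) :=
      hφ.comp (by fun_prop)
    simp only [Bool.false_eq_true, if_false, h1]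
    rw [errLaw, lintegral_prod _ h2.aemeasurable, ← hm.map_gap,
      lintegral_map h2.lintegral_prod_right' (by fun_prop)]
    exact (lintegral_prod _ (h2.lintegral_prod_right'.comp
      (by fun_prop : Measurable fun x : (Fin nx → ℝ) × (Fin nx → ℝ) =>
        m.A *ᵥ x.1 + x.2)).aemeasurable).symm

/-- Given the controller's information, the gap and the sensor's error are independent centred
Gaussians with covariances `f^{τ+1}(P̄) - P̄` and `P̄`, whatever the strategies. -/
theorem lintegral_loopState {m : Model nx nu ny} (hm : m.Valid) (pol : ControllerPolicy nx nu)
    (α : AttackPolicy) (k : ℕ) {φ : LoopState nx nu k → ENNReal} (hφ : Measurable φ) :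
    ∫⁻ ω, φ (m.loopState pol α k ω) ∂m.law =
      ∫⁻ ω, m.errAvg φ (m.loopState pol α k ω).1 ∂m.law := by
  induction k with
  | zero =>
    simp only [loopState_zero]
    have h1 : Measurable fun a : (Fin nx → ℝ) × (Fin nx → ℝ) × (Fin nx → ℝ) =>
        φ ((a.1, Fin.elim0), a.2) := hφ.comp (by fun_prop)
    have h2 : Measurable fun a : Fin nx → ℝ =>
        m.errAvg φ ((a, Fin.elim0) : Info nx nu 0) :=
      (m.measurable_errAvg hφ).comp (by fun_prop)
    unfold law
    refine (lintegral_prod_fst _ _ h1).trans (Eq.trans ?_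
      (lintegral_prod_fst _ _ (h2.comp measurable_fst)).symm)
    rw [lintegral_prod _ h1.aemeasurable]
    exact (lintegral_prod_fst _ _ h2).symm
  | succ k ih =>
    have hstep := m.measurable_stepState pol α k
    have key : ∀ ψ : LoopState nx nu (k + 1) → ENNReal, Measurable ψ →
        ∫⁻ ω, ψ (m.loopState pol α (k + 1) ω) ∂m.law =
          ∫⁻ ω, ∫⁻ s, ∫⁻ d, ∫⁻ y, ψ (m.nextInfo pol α k (m.loopState pol α k ω).1 d s,
            m.A *ᵥ m.residualGap pol α k (m.loopState pol α k ω).1 d s + y.1, y.2) ∂m.errLaw 0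
              ∂gaussianVec (m.gapCov (m.hold (m.loopState pol α k ω).1)) ∂seedLaw ∂m.law := by
      intro ψ hψ
      simp only [loopState_succ]
      refine (m.lintegral_loopState_stage pol α k (hψ.comp hstep)).trans
        ((ih (hψ.comp hstep).lintegral_prod_right').trans ?_)
      refine lintegral_congr fun ω => ?_
      rw [errAvg]
      have hres := m.measurable_residualGap pol α k
      have hni := m.measurable_nextInfo pol α k
      set I := (m.loopState pol α k ω).1
      have hp : Measurable fun p : Seeds × (Fin nx → ℝ) × (Fin nx → ℝ) × (Fin nx → ℝ) =>
          (I, p.2.1, p.1) := by fun_prop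
      exact lintegral_errLaw_stage hm (m.hold I)
        (g := fun p => ψ (m.nextInfo pol α k I p.2.1 p.1,
          m.A *ᵥ m.residualGap pol α k I p.2.1 p.1 + p.2.2.1, p.2.2.2))
        (hψ.comp ((hni.comp hp).prodMk (((measurable_mulVec_comp _ (hres.comp hp)).add
          (by fun_prop)).prodMk (by fun_prop))))
    rw [key φ hφ]
    refine Eq.trans ?_ (key _ ((m.measurable_errAvg hφ).comp measurable_fst)).symm
    refine lintegral_congr fun ω => lintegral_congr fun s => ?_
    rw [lintegral_step_errors hm pol α k _ s hφ]
    simp only [Function.comp_def, lintegral_const, measure_univ, mul_one]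

/-- Expectation of a function of the loop state and the seeds: the seeds, the gap and the sensor's
error may be averaged over independently, given the controller's information. -/
theorem lintegral_loopState_seeds {m : Model nx nu ny} (hm : m.Valid)
    (pol : ControllerPolicy nx nu) (α : AttackPolicy) (k : ℕ)
    {Φ : LoopState nx nu k × Seeds → ENNReal} (hΦ : Measurable Φ) :
    ∫⁻ ω, Φ (m.loopState pol α k ω, (ω.2 k).2.2) ∂m.law =
      ∫⁻ ω, ∫⁻ s, ∫⁻ y, Φ (((m.loopState pol α k ω).1, y), s)
        ∂m.errLaw (m.hold (m.loopState pol α k ω).1) ∂seedLaw ∂m.law := by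
  have hΦ' : Measurable fun p : LoopState nx nu k × StageNoise nx ny => Φ (p.1, p.2.2.2) :=
    hΦ.comp (by fun_prop)
  rw [m.lintegral_loopState_stage pol α k hΦ']
  have hst : ∀ y : LoopState nx nu k, ∫⁻ z : StageNoise nx ny, Φ (y, z.2.2) ∂m.stageLaw =
      ∫⁻ s, Φ (y, s) ∂seedLaw := by
    intro y
    have h1 : Measurable fun s => Φ (y, s) := hΦ.comp measurable_prodMk_left
    exact (lintegral_prod_snd _ _ (h1.comp measurable_snd)).trans (lintegral_prod_snd _ _ h1)
  simp only [hst]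
  rw [lintegral_loopState hm pol α k hΦ.lintegral_prod_right']
  refine lintegral_congr fun ω => ?_
  exact lintegral_lintegral_swap (f := fun y s => Φ (((m.loopState pol α k ω).1, y), s))
    (hΦ.comp (by fun_prop)).aemeasurable

end Model

namespace Model

/-! ### The cost identity -/

/-- The state of the plant in terms of the loop state. -/
def plantState (m : Model nx nu ny) {k : ℕ} (y : LoopState nx nu k) : Fin nx → ℝ :=
  m.predEstimate k y.1 + y.2.1 + y.2.2

@[fun_prop]
theorem measurable_plantState (m : Model nx nu ny) {k : ℕ} :
    Measurable (m.plantState : LoopState nx nu k → Fin nx → ℝ) := by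
  unfold plantState
  fun_prop

theorem measurable_run_x (m : Model nx nu ny) (pol : ControllerPolicy nx nu) (α : AttackPolicy)
    (k : ℕ) : Measurable fun ω : Sample nx ny => (m.run pol α ω k).x := by
  simp only [run_x_eq]
  exact m.measurable_plantState.comp (m.measurable_loopState pol α k)

theorem measurable_inputAt (m : Model nx nu ny) (pol : ControllerPolicy nx nu) (α : AttackPolicy)
    (k : ℕ) : Measurable (m.inputAt pol α k : Sample nx ny → _) := by
  rw [funext (m.inputAt_eq pol α k)]
  exact (m.measurable_drawInput pol α k).comp (m.measurable_loopState_seeds pol α k)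

theorem measurable_estimateAt (m : Model nx nu ny) (pol : ControllerPolicy nx nu)
    (α : AttackPolicy) (k : ℕ) :
    Measurable (m.estimateAt pol α k : Sample nx ny → _) := by
  have h := m.measurable_loopState pol α k
  rw [funext (m.estimateAt_eq pol α k)]
  have h2 := (m.measurable_residualGap pol α k).comp (m.measurable_loopState_seeds pol α k)
  exact ((m.measurable_predEstimate_comp k h.fst).add h.snd.fst).sub h2

/-- Two functions of the loop state and the stage randomness with the same average over the
process noise have the same expectation. -/
theorem lintegral_stage_congr (m : Model nx nu ny) (pol : ControllerPolicy nx nu)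
    (α : AttackPolicy) (k : ℕ) {Φ Ψ : LoopState nx nu k × StageNoise nx ny → ENNReal}
    (hΦ : Measurable Φ) (hΨ : Measurable Ψ)
    (h : ∀ y r, ∫⁻ w, Φ (y, w, r) ∂gaussianVec m.Q = ∫⁻ w, Ψ (y, w, r) ∂gaussianVec m.Q) :
    ∫⁻ ω, Φ (m.loopState pol α k ω, ω.2 k) ∂m.law =
      ∫⁻ ω, Ψ (m.loopState pol α k ω, ω.2 k) ∂m.law := by
  rw [m.lintegral_loopState_stage pol α k hΦ, m.lintegral_loopState_stage pol α k hΨ]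
  refine lintegral_congr fun ω => ?_
  refine (lintegral_prod_symm' _ (hΦ.comp measurable_prodMk_left)).trans
    (Eq.trans ?_ (lintegral_prod_symm' _ (hΨ.comp measurable_prodMk_left)).symm)
  exact lintegral_congr fun r => h _ r

/-- Expected quadratic stage cost. -/
def stageQuad (m : Model nx nu ny) (pol : ControllerPolicy nx nu) (α : AttackPolicy) (k : ℕ) :
    ENNReal :=
  ∫⁻ ω, ENNReal.ofReal (quad m.W (m.run pol α ω k).x + quad m.U (m.inputAt pol α k ω)) ∂m.law

/-- Expected value of the quadratic form of `S_k` at the state of time `k`. -/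
def stateQuad (m : Model nx nu ny) (pol : ControllerPolicy nx nu) (α : AttackPolicy) (k : ℕ) :
    ENNReal :=
  ∫⁻ ω, ENNReal.ofReal (quad (m.S k) (m.run pol α ω k).x) ∂m.law

/-- Expected cost of the deviation of `u_k` from `-L_k x̂_k`. -/
def deviation (m : Model nx nu ny) (pol : ControllerPolicy nx nu) (α : AttackPolicy) (k : ℕ) :
    ENNReal :=
  ∫⁻ ω, ENNReal.ofReal (quad (m.gainWeight k)
    (m.inputAt pol α k ω + m.L k *ᵥ m.estimateAt pol α k ω)) ∂m.law

/-- The holding time `τ_k` in the closed loop. -/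
def holdAt (m : Model nx nu ny) (pol : ControllerPolicy nx nu) (α : AttackPolicy) (k : ℕ)
    (ω : Sample nx ny) : ℕ :=
  m.hold (m.loopState pol α (k + 1) ω).1

/-- The cost `tr(Lᵀ (η Bᵀ S_{k+1} B + U) L f^{τ_k}(P̄))` of the estimation error. -/
def errCost (m : Model nx nu ny) (k t : ℕ) : ℝ := trace (m.errWeight k * m.f^[t] m.Pbar)

theorem errCost_nonneg {m : Model nx nu ny} (hm : m.Valid) {k : ℕ} (hk : k ≤ m.K) (t : ℕ) :
    0 ≤ m.errCost k t :=
  trace_mul_nonneg (hm.posSemidef_errWeight hk) (hm.posSemidef_iterate_f t)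

/-- One stage of the telescoping sum, as an identity in `[0, ∞]`. -/
theorem stateQuad_step {m : Model nx nu ny} (hm : m.Valid) (pol : ControllerPolicy nx nu)
    (α : AttackPolicy) {k : ℕ} (hk : k ≤ m.K) :
    ENNReal.ofReal m.eta * m.stateQuad pol α (k + 1) + m.stageQuad pol α k =
      m.stateQuad pol α k + ∫⁻ ω, ENNReal.ofReal (quad (m.gainWeight k)
          (m.inputAt pol α k ω + m.L k *ᵥ (m.run pol α ω k).x)) ∂m.law
        + ENNReal.ofReal (m.eta * trace (m.S (k + 1) * m.Q)) := by
  have hx := m.measurable_run_x pol α k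
  have hx' := m.measurable_run_x pol α (k + 1)
  have hu := m.measurable_inputAt pol α k
  have hy : Measurable fun p : LoopState nx nu k × StageNoise nx ny => m.plantState p.1 := by
    fun_prop
  have hw : Measurable fun p : LoopState nx nu k × StageNoise nx ny => p.2.1 := by fun_prop
  have hdu : Measurable fun p : LoopState nx nu k × StageNoise nx ny =>
      m.drawInput pol α k p.1.1 p.1.2.1 p.2.2.2 :=
    (m.measurable_drawInput pol α k).comp
      (by fun_prop : Measurable fun p : LoopState nx nu k × StageNoise nx ny =>
        (p.1.1, p.1.2.1, p.2.2.2))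
  have hF1 : Measurable fun p : LoopState nx nu k × StageNoise nx ny =>
      ENNReal.ofReal (m.eta * quad (m.S (k + 1)) (m.A *ᵥ m.plantState p.1
        + m.B *ᵥ m.drawInput pol α k p.1.1 p.1.2.1 p.2.2.2 + p.2.1)) :=
    ((measurable_quad_comp _ (((measurable_mulVec_comp _ hy).add
      (measurable_mulVec_comp _ hdu)).add hw)).const_mul _).ennreal_ofReal
  have hF2 : Measurable fun p : LoopState nx nu k × StageNoise nx ny =>
      ENNReal.ofReal (quad m.W (m.plantState p.1)
        + quad m.U (m.drawInput pol α k p.1.1 p.1.2.1 p.2.2.2)) :=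
    ((measurable_quad_comp _ hy).add (measurable_quad_comp _ hdu)).ennreal_ofReal
  have hG1 : Measurable fun p : LoopState nx nu k × StageNoise nx ny =>
      ENNReal.ofReal (quad (m.S k) (m.plantState p.1)) :=
    (measurable_quad_comp _ hy).ennreal_ofReal
  have hG2 : Measurable fun p : LoopState nx nu k × StageNoise nx ny =>
      ENNReal.ofReal (quad (m.gainWeight k) (m.drawInput pol α k p.1.1 p.1.2.1 p.2.2.2
        + m.L k *ᵥ m.plantState p.1)) :=
    (measurable_quad_comp _ (hdu.add (measurable_mulVec_comp _ hy))).ennreal_ofReal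
  have key := m.lintegral_stage_congr pol α k (hF1.add hF2) ((hG1.add hG2).add_const
    (ENNReal.ofReal (m.eta * trace (m.S (k + 1) * m.Q)))) (fun y r => by
      simp only [Pi.add_apply]
      rw [lintegral_add_right _ measurable_const, lintegral_const, lintegral_const, measure_univ,
        mul_one, mul_one]
      exact hm.lintegral_next hk _ _)
  have hloop : ∀ ω : Sample nx ny, m.plantState (m.loopState pol α k ω) = (m.run pol α ω k).x :=
    fun ω => (m.run_x_eq pol α k ω).symm
  simp only [Pi.add_apply, hloop, ← inputAt_eq, ← run_next_x] at key
  rw [lintegral_add_left, lintegral_add_right _ measurable_const,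
    lintegral_add_left (measurable_quad_comp _ hx).ennreal_ofReal, lintegral_const, measure_univ,
    mul_one] at key
  · rw [stateQuad, stageQuad, stateQuad, ← key, ← lintegral_const_mul _
      (measurable_quad_comp _ hx').ennreal_ofReal]
    simp only [ENNReal.ofReal_mul hm.eta_pos.le]
  · exact ((measurable_quad_comp _ hx').const_mul _).ennreal_ofReal

/-- The second moment of `x_k - x̂_k` when the packet does not arrive: covariance `f^{t+1}(P̄)`. -/
theorem lintegral_quad_errLaw {m : Model nx nu ny} (hm : m.Valid) {p : ℕ}
    {S : Matrix (Fin p) (Fin p) ℝ} (hS : S.PosSemidef) (N : Matrix (Fin p) (Fin nx) ℝ) (t : ℕ)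
    (z : Fin p → ℝ) :
    ∫⁻ y, ENNReal.ofReal (quad S (z + N *ᵥ (y.1 + y.2))) ∂m.errLaw t =
      ENNReal.ofReal (quad S z) + ENNReal.ofReal (trace (Nᵀ * S * N * m.f^[t + 1] m.Pbar)) := by
  have hN := PosSemidef.congr_transpose hS N
  have h1 : Measurable fun y : (Fin nx → ℝ) × (Fin nx → ℝ) =>
      ENNReal.ofReal (quad S (z + N *ᵥ (y.1 + y.2))) :=
    (measurable_quad_comp _ (by fun_prop)).ennreal_ofReal
  have h2 : Measurable fun d : Fin nx → ℝ => ENNReal.ofReal (quad S (z + N *ᵥ d)) :=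
    (measurable_quad_comp _ (by fun_prop)).ennreal_ofReal
  have p1 := trace_mul_nonneg hN hm.hPbar
  have p2 := trace_mul_nonneg hN (hm.posSemidef_gapCov t)
  rw [errLaw, lintegral_prod _ h1.aemeasurable]
  simp only [mulVec_add, ← add_assoc]
  simp only [lintegral_quad_add_gaussianVec hS hm.hPbar, ENNReal.ofReal_add (quad_nonneg hS _) p1]
  rw [lintegral_add_left h2, lintegral_const, measure_univ, mul_one,
    lintegral_quad_add_gaussianVec hS (hm.posSemidef_gapCov t),
    ENNReal.ofReal_add (quad_nonneg hS _) p2, iterate_f_eq, Matrix.mul_add, trace_add,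
    ENNReal.ofReal_add p2 p1, add_assoc]

/-- When the packet arrives, only the sensor's error is averaged over: the vector `v` may depend on
the gap. -/
theorem lintegral_quad_errLaw_of_arrival {m : Model nx nu ny} (hm : m.Valid) {p : ℕ}
    {S : Matrix (Fin p) (Fin p) ℝ} (hS : S.PosSemidef) (N : Matrix (Fin p) (Fin nx) ℝ) (t : ℕ)
    {v : (Fin nx → ℝ) → Fin p → ℝ} (hv : Measurable v) (c : Fin nx → ℝ) :
    ∫⁻ y, ENNReal.ofReal (quad S (v y.1 + N *ᵥ (c + y.1 + y.2))) ∂m.errLaw t =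
      ∫⁻ y, (ENNReal.ofReal (quad S (v y.1 + N *ᵥ (c + y.1)))
        + ENNReal.ofReal (trace (Nᵀ * S * N * m.Pbar))) ∂m.errLaw t := by
  have hf : Measurable fun y : (Fin nx → ℝ) × (Fin nx → ℝ) => ENNReal.ofReal
      (quad S (v y.1 + N *ᵥ (c + y.1 + y.2))) :=
    (measurable_quad_comp _ (by fun_prop)).ennreal_ofReal
  have hg : Measurable fun d : Fin nx → ℝ => ENNReal.ofReal (quad S (v d + N *ᵥ (c + d)))
      + ENNReal.ofReal (trace (Nᵀ * S * N * m.Pbar)) :=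
    (measurable_quad_comp _ (by fun_prop)).ennreal_ofReal.add_const _
  rw [errLaw, lintegral_prod _ hf.aemeasurable]
  refine Eq.trans (lintegral_congr fun d => ?_) (lintegral_prod_fst _ _ hg).symm
  simp only [mulVec_add _ (c + d), ← add_assoc (v d)]
  rw [lintegral_quad_add_gaussianVec hS hm.hPbar,
    ENNReal.ofReal_add (quad_nonneg hS _)
      (trace_mul_nonneg (PosSemidef.congr_transpose hS N) hm.hPbar)]

/-- For fixed information and seeds, the estimation error contributes its covariance and no cross
term: the input depends on the gap only through a packet that has arrived. -/
theorem lintegral_errLaw_deviation {m : Model nx nu ny} (hm : m.Valid)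
    (pol : ControllerPolicy nx nu) (α : AttackPolicy) {k : ℕ} (hk : k ≤ m.K)
    (I : Info nx nu k) (s : Seeds) :
    ∫⁻ y, ENNReal.ofReal (quad (m.gainWeight k)
        (m.drawInput pol α k I y.1 s + m.L k *ᵥ (m.predEstimate k I + y.1 + y.2)))
          ∂m.errLaw (m.hold I) =
      ∫⁻ y, (ENNReal.ofReal (quad (m.gainWeight k) (m.drawInput pol α k I y.1 s
          + m.L k *ᵥ (m.predEstimate k I + y.1 - m.residualGap pol α k I y.1 s)))
        + ENNReal.ofReal (m.errCost k (m.hold (m.nextInfo pol α k I y.1 s))))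
          ∂m.errLaw (m.hold I) := by
  have hM := (hm.posDef_gainWeight hk).posSemidef
  simp only [hold_nextInfo]
  cases h : m.drawArrival pol α k I s with
  | true =>
    have hr : ∀ d, m.residualGap pol α k I d s = 0 := by simp [residualGap, h]
    have hv : Measurable fun d => m.drawInput pol α k I d s :=
      (m.measurable_drawInput pol α k).comp
        (measurable_const.prodMk (measurable_id.prodMk measurable_const))
    simp only [if_true, hr, sub_zero]
    exact lintegral_quad_errLaw_of_arrival hm hM (m.L k) (m.hold I) hv (m.predEstimate k I)
  | false =>
    have hr : ∀ d, m.residualGap pol α k I d s = d := by simp [residualGap, h]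
    have hu : ∀ d, m.drawInput pol α k I d s = m.drawInput pol α k I 0 s := by
      intro d
      simp [drawInput, drawObs, h]
    simp only [hu, hr, Bool.false_eq_true, if_false, add_sub_cancel_right]
    rw [lintegral_const, measure_univ, mul_one]
    simp only [add_assoc (m.predEstimate k I), mulVec_add _ (m.predEstimate k I),
      ← add_assoc (m.drawInput pol α k I 0 s)]
    exact lintegral_quad_errLaw hm hM (m.L k) (m.hold I) _

/-- The estimation error is orthogonal to the information on which the input depends. -/
theorem lintegral_gain_deviation {m : Model nx nu ny} (hm : m.Valid)
    (pol : ControllerPolicy nx nu) (α : AttackPolicy) {k : ℕ} (hk : k ≤ m.K) :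
    ∫⁻ ω, ENNReal.ofReal (quad (m.gainWeight k)
        (m.inputAt pol α k ω + m.L k *ᵥ (m.run pol α ω k).x)) ∂m.law =
      m.deviation pol α k + ∫⁻ ω, ENNReal.ofReal (m.errCost k (m.holdAt pol α k ω)) ∂m.law := by
  have hdu : Measurable fun p : LoopState nx nu k × Seeds =>
      m.drawInput pol α k p.1.1 p.1.2.1 p.2 :=
    (m.measurable_drawInput pol α k).comp
      (by fun_prop : Measurable fun p : LoopState nx nu k × Seeds => (p.1.1, p.1.2.1, p.2))
  have hdr : Measurable fun p : LoopState nx nu k × Seeds =>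
      m.residualGap pol α k p.1.1 p.1.2.1 p.2 :=
    (m.measurable_residualGap pol α k).comp
      (by fun_prop : Measurable fun p : LoopState nx nu k × Seeds => (p.1.1, p.1.2.1, p.2))
  have hdi : Measurable fun p : LoopState nx nu k × Seeds =>
      m.nextInfo pol α k p.1.1 p.1.2.1 p.2 :=
    (m.measurable_nextInfo pol α k).comp
      (by fun_prop : Measurable fun p : LoopState nx nu k × Seeds => (p.1.1, p.1.2.1, p.2))
  have hF : Measurable fun p : LoopState nx nu k × Seeds => ENNReal.ofReal (quad (m.gainWeight k)
      (m.drawInput pol α k p.1.1 p.1.2.1 p.2 + m.L k *ᵥ m.plantState p.1)) :=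
    (measurable_quad_comp _ (hdu.add (by fun_prop))).ennreal_ofReal
  have hG1 : Measurable fun p : LoopState nx nu k × Seeds => ENNReal.ofReal (quad (m.gainWeight k)
      (m.drawInput pol α k p.1.1 p.1.2.1 p.2 + m.L k *ᵥ (m.predEstimate k p.1.1 + p.1.2.1
        - m.residualGap pol α k p.1.1 p.1.2.1 p.2))) :=
    (measurable_quad_comp _ (hdu.add (measurable_mulVec_comp _
      ((by fun_prop : Measurable fun p : LoopState nx nu k × Seeds =>
        m.predEstimate k p.1.1 + p.1.2.1).sub hdr)))).ennreal_ofReal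
  have hG2 : Measurable fun p : LoopState nx nu k × Seeds => ENNReal.ofReal
      (m.errCost k (m.hold (m.nextInfo pol α k p.1.1 p.1.2.1 p.2))) :=
    ((measurable_of_countable (m.errCost k)).comp (m.measurable_hold.comp hdi)).ennreal_ofReal
  have e1 := lintegral_loopState_seeds hm pol α k hF
  have e2 := lintegral_loopState_seeds hm pol α k (hG1.add hG2)
  have e3 : ∀ ω : Sample nx ny, m.plantState (m.loopState pol α k ω) = (m.run pol α ω k).x :=
    fun ω => (m.run_x_eq pol α k ω).symm
  have e4 : ∀ ω : Sample nx ny, m.nextInfo pol α k (m.loopState pol α k ω).1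
      (m.loopState pol α k ω).2.1 (ω.2 k).2.2 = (m.loopState pol α (k + 1) ω).1 :=
    fun ω => by rw [loopState_succ]; rfl
  simp only [Pi.add_apply, e3, e4, ← inputAt_eq, ← estimateAt_eq] at e1 e2
  rw [e1, deviation, ← lintegral_add_left]
  · refine Eq.trans ?_ e2.symm
    refine lintegral_congr fun ω => lintegral_congr fun s => ?_
    exact lintegral_errLaw_deviation hm pol α hk _ s
  · exact (measurable_quad_comp _ ((m.measurable_inputAt pol α k).add
      (measurable_mulVec_comp _ (m.measurable_estimateAt pol α k)))).ennreal_ofReal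

theorem stateQuad_zero {m : Model nx nu ny} (hm : m.Valid) (pol : ControllerPolicy nx nu)
    (α : AttackPolicy) : m.stateQuad pol α 0 =
      ENNReal.ofReal (trace (m.S 0 * (m.Sig0 + m.f^[m.t0 + 1] m.Pbar))) := by
  have hS := hm.posSemidef_S (Nat.zero_le _)
  have h0 : ∀ ω : Sample nx ny, (m.run pol α ω 0).x = ω.1.1 + ω.1.2.1 + ω.1.2.2 := fun _ => rfl
  have hmeas : Measurable fun a : (Fin nx → ℝ) × (Fin nx → ℝ) × (Fin nx → ℝ) =>
      ENNReal.ofReal (quad (m.S 0) (a.1 + a.2.1 + a.2.2)) :=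
    (measurable_quad_comp _ (by fun_prop)).ennreal_ofReal
  unfold stateQuad law
  simp only [h0]
  refine (lintegral_prod_fst _ _ hmeas).trans ?_
  rw [lintegral_prod _ hmeas.aemeasurable]
  have h1 : ∀ a : Fin nx → ℝ, ∫⁻ y : (Fin nx → ℝ) × (Fin nx → ℝ),
      ENNReal.ofReal (quad (m.S 0) (a + y.1 + y.2))
        ∂((gaussianVec (m.f^[m.t0 + 1] m.Pbar - m.Pbar)).prod (gaussianVec m.Pbar)) =
      ENNReal.ofReal (quad (m.S 0) a) +
        ENNReal.ofReal (trace (m.S 0 * m.f^[m.t0 + 1] m.Pbar)) := by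
    intro a
    have h := lintegral_quad_errLaw hm hS 1 m.t0 a
    simp only [one_mulVec, transpose_one, Matrix.one_mul, Matrix.mul_one, ← add_assoc] at h
    exact h
  simp only [h1]
  rw [lintegral_add_right _ measurable_const, lintegral_const, measure_univ, mul_one]
  have h2 := lintegral_quad_add_gaussianVec hS hm.hSig0 1 0
  simp only [one_mulVec, transpose_one, Matrix.one_mul, Matrix.mul_one, zero_add] at h2
  have h3 : quad (m.S 0) 0 = 0 := by simp [quad]
  rw [h2, h3, zero_add, ← ENNReal.ofReal_add (trace_mul_nonneg hS hm.hSig0)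
    (trace_mul_nonneg hS (hm.posSemidef_iterate_f _)), Matrix.mul_add, trace_add]

/-- Total expected cost of the deviations from the linear control. -/
def totalDeviation (m : Model nx nu ny) (pol : ControllerPolicy nx nu) (α : AttackPolicy) :
    ENNReal :=
  ∑ k ∈ Finset.range (m.K + 1), ENNReal.ofReal m.eta ^ k * m.deviation pol α k

/-- Telescoping: no finiteness of the expectations is needed. -/
theorem sum_stageQuad_add {m : Model nx nu ny} (hm : m.Valid) (pol : ControllerPolicy nx nu)
    (α : AttackPolicy) {n : ℕ} (hn : n ≤ m.K + 1) :
    ∑ k ∈ Finset.range n, ENNReal.ofReal m.eta ^ k * m.stageQuad pol α k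
        + ENNReal.ofReal m.eta ^ n * m.stateQuad pol α n =
      m.stateQuad pol α 0 + ∑ k ∈ Finset.range n, ENNReal.ofReal m.eta ^ k *
        (m.deviation pol α k + ∫⁻ ω, ENNReal.ofReal (m.errCost k (m.holdAt pol α k ω)) ∂m.law
          + ENNReal.ofReal (m.eta * trace (m.S (k + 1) * m.Q))) := by
  induction n with
  | zero => simp
  | succ n ih =>
    have hn' : n ≤ m.K := Nat.lt_succ_iff.mp hn
    have h := stateQuad_step hm pol α hn'
    rw [lintegral_gain_deviation hm pol α hn'] at h
    rw [Finset.sum_range_succ, Finset.sum_range_succ, ← add_assoc, ← ih (Nat.le_of_succ_le hn),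
      pow_succ, mul_assoc, add_assoc, ← mul_add, add_comm (m.stageQuad pol α n), h, mul_add,
      mul_add, mul_add, mul_add, mul_add]
    ring

theorem lintegral_quadCost {m : Model nx nu ny} (hm : m.Valid) (pol : ControllerPolicy nx nu)
    (α : AttackPolicy) :
    ∫⁻ ω, ENNReal.ofReal (m.quadCost pol α ω) ∂m.law =
      ∑ k ∈ Finset.range (m.K + 1), ENNReal.ofReal m.eta ^ k * m.stageQuad pol α k
        + ENNReal.ofReal m.eta ^ (m.K + 1) * m.stateQuad pol α (m.K + 1) := by
  have hη := hm.eta_pos.le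
  have hq : ∀ ω : Sample nx ny, ENNReal.ofReal (m.quadCost pol α ω) =
      ∑ k ∈ Finset.range (m.K + 1), ENNReal.ofReal m.eta ^ k *
        ENNReal.ofReal (quad m.W (m.run pol α ω k).x + quad m.U (m.inputAt pol α k ω))
      + ENNReal.ofReal m.eta ^ (m.K + 1) *
        ENNReal.ofReal (quad (m.S (m.K + 1)) (m.run pol α ω (m.K + 1)).x) := by
    intro ω
    have hs : ∀ k, 0 ≤ quad m.W (m.run pol α ω k).x + quad m.U (m.inputAt pol α k ω) :=
      fun k => add_nonneg (quad_nonneg hm.hW _) (quad_nonneg hm.hU.posSemidef _)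
    simp only [← ENNReal.ofReal_pow hη, ← ENNReal.ofReal_mul (pow_nonneg hη _)]
    rw [← ENNReal.ofReal_sum_of_nonneg fun k _ => mul_nonneg (pow_nonneg hη _) (hs k),
      ← ENNReal.ofReal_add (Finset.sum_nonneg fun k _ => mul_nonneg (pow_nonneg hη _) (hs k))
        (mul_nonneg (pow_nonneg hη _) (quad_nonneg (hm.posSemidef_S le_rfl) _)), S_terminal]
    rfl
  have hm1 : ∀ k, Measurable fun ω : Sample nx ny => ENNReal.ofReal
      (quad m.W (m.run pol α ω k).x + quad m.U (m.inputAt pol α k ω)) := fun k =>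
    ((measurable_quad_comp _ (m.measurable_run_x pol α k)).add
      (measurable_quad_comp _ (m.measurable_inputAt pol α k))).ennreal_ofReal
  simp only [hq]
  rw [lintegral_add_left (Finset.measurable_sum _ fun k _ => (hm1 k).const_mul _),
    lintegral_finsetSum _ fun k _ => (hm1 k).const_mul _,
    lintegral_const_mul _ (measurable_quad_comp _ (m.measurable_run_x pol α _)).ennreal_ofReal]
  simp only [lintegral_const_mul _ (hm1 _)]
  rfl

end Model

/-! ### Reduction to the tree of acknowledgments -/

theorem integrable_comp_of_finite {Ω X : Type*} [MeasurableSpace Ω] [Finite X]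
    [MeasurableSpace X] [MeasurableSingletonClass X] {μ : Measure Ω} [IsProbabilityMeasure μ]
    {Y : Ω → X} (hY : Measurable Y) (F : X → ℝ) : Integrable (fun ω => F (Y ω)) μ := by
  have := Measure.isProbabilityMeasure_map (μ := μ) hY.aemeasurable
  exact (Integrable.of_finite (f := F) (μ := μ.map Y)).comp_measurable hY

theorem integral_comp_eq_sum {Ω X : Type*} [MeasurableSpace Ω] [Fintype X]
    [MeasurableSpace X] [MeasurableSingletonClass X] {μ : Measure Ω} [IsProbabilityMeasure μ]
    {Y : Ω → X} (hY : Measurable Y) (F : X → ℝ) :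
    ∫ ω, F (Y ω) ∂μ = ∑ x, μ.real (Y ⁻¹' {x}) * F x := by
  have := Measure.isProbabilityMeasure_map (μ := μ) hY.aemeasurable
  rw [← integral_map hY.aemeasurable (measurable_of_finite F).aestronglyMeasurable,
    integral_fintype Integrable.of_finite]
  refine Finset.sum_congr rfl fun x _ => ?_
  rw [smul_eq_mul, measureReal_def, Measure.map_apply hY (measurableSet_singleton x),
    measureReal_def]

theorem prob_nonneg (q : unitInterval) (b : Bool) : 0 ≤ Model.prob q b := by
  unfold Model.prob
  split_ifs
  · exact q.2.1
  · exact sub_nonneg.mpr q.2.2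

theorem volume_decide_lt (q : unitInterval) (b : Bool) :
    volume {x : unitInterval | decide (x < q) = b} = ENNReal.ofReal (Model.prob q b) := by
  cases b with
  | true =>
    have : {x : unitInterval | decide (x < q) = true} = Set.Iio q := by ext; simp
    rw [this, unitInterval.volume_Iio]
    rfl
  | false =>
    have : {x : unitInterval | decide (x < q) = false} = Set.Ici q := by ext; simp
    rw [this, unitInterval.volume_Ici]
    rfl

namespace Model

/-- The probability that a packet arrives, given the two decisions. -/
def arrivalProb (m : Model nx nu ny) (v a : Bool) : ℝ := if v then m.succProb a else 0

/-- The probability of the value `b` of the arrival indicator, given the two decisions. -/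
def channel (m : Model nx nu ny) (v a b : Bool) : ℝ :=
  if b then m.arrivalProb v a else 1 - m.arrivalProb v a

theorem succProb_mem {m : Model nx nu ny} (hm : m.Valid) (a : Bool) :
    m.succProb a ∈ unitInterval := by
  unfold succProb
  have h1 := hm.lamA_nonneg
  have h2 := hm.lamA_lt
  have h3 := hm.lam_le
  split_ifs <;> constructor <;> linarith

theorem arrivalProb_mem {m : Model nx nu ny} (hm : m.Valid) (v a : Bool) :
    m.arrivalProb v a ∈ unitInterval := by
  unfold arrivalProb
  split_ifs
  · exact succProb_mem hm a
  · exact unitInterval.zero_mem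

theorem channel_nonneg {m : Model nx nu ny} (hm : m.Valid) (v a b : Bool) :
    0 ≤ m.channel v a b :=
  prob_nonneg ⟨_, arrivalProb_mem hm v a⟩ b

theorem volume_channel {m : Model nx nu ny} (hm : m.Valid) (v a b : Bool) :
    volume {x : unitInterval | (v && decide ((x : ℝ) < m.succProb a)) = b} =
      ENNReal.ofReal (m.channel v a b) := by
  have h := volume_decide_lt ⟨_, arrivalProb_mem hm v a⟩ b
  refine Eq.trans (congrArg _ (Set.ext fun x => ?_)) h
  cases v with
  | true => rfl
  | false =>
    have : ¬ (x < ⟨m.arrivalProb false a, arrivalProb_mem hm false a⟩) := not_lt.mpr x.2.1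
    simp only [Set.mem_ofPred_eq, Bool.false_and, this, decide_false]

/-- What happens in one stage, as far as the costs other than the quadratic one are concerned:
the past acknowledgments, the two decisions and the new acknowledgment. -/
abbrev Outcome (k : ℕ) : Type := (Fin k → Bool) × Bool × Bool × Bool

/-- The outcome of a stage as a function of the information and the seeds. -/
def drawOutcome (m : Model nx nu ny) (pol : ControllerPolicy nx nu) (α : AttackPolicy) (k : ℕ)
    (I : Info nx nu k) (s : Seeds) : Outcome k :=
  (acks I, drawSched pol k I s, drawAttack α k (acks I) s, m.drawArrival pol α k I s)

/-- The outcome of a stage in the closed loop. -/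
def outcome (m : Model nx nu ny) (pol : ControllerPolicy nx nu) (α : AttackPolicy) (k : ℕ)
    (ω : Sample nx ny) : Outcome k :=
  m.drawOutcome pol α k (m.loopState pol α k ω).1 (ω.2 k).2.2

section Outcome

variable (m : Model nx nu ny) (pol : ControllerPolicy nx nu) (α : AttackPolicy) (k : ℕ)

theorem measurable_drawOutcome :
    Measurable fun p : Info nx nu k × Seeds => m.drawOutcome pol α k p.1 p.2 :=
  (measurable_acks.comp measurable_fst).prodMk ((measurable_drawSched pol k).prodMk
    ((measurable_drawAttack α k).prodMk (m.measurable_drawArrival pol α k)))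

theorem measurable_outcome : Measurable (m.outcome pol α k : Sample nx ny → Outcome k) := by
  have h := m.measurable_loopState_seeds pol α k
  exact (m.measurable_drawOutcome pol α k).comp (h.fst.prodMk h.snd.snd)

theorem measurable_acks_loopState :
    Measurable fun ω : Sample nx ny => acks (m.loopState pol α k ω).1 :=
  measurable_acks.comp (m.measurable_loopState pol α k).fst

theorem acks_loopState_succ (ω : Sample nx ny) : acks (m.loopState pol α (k + 1) ω).1 =
    Fin.snoc (α := fun _ => Bool) (m.outcome pol α k ω).1 (m.outcome pol α k ω).2.2.2 := by
  rw [loopState_succ]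
  exact acks_nextInfo m pol α k _ _ _

theorem seedLaw_drawOutcome {m : Model nx nu ny} (hm : m.Valid) (I : Info nx nu k)
    (v a b : Bool) :
    seedLaw {s | m.drawOutcome pol α k I s = (acks I, v, a, b)} =
      ENNReal.ofReal (prob (pol.sched k I) v * (prob (α k (acks I)) a * m.channel v a b)) := by
  have hset : {s : Seeds | m.drawOutcome pol α k I s = (acks I, v, a, b)} =
      {x : unitInterval | decide (x < pol.sched k I) = v} ×ˢ
        ((Set.univ : Set unitInterval) ×ˢ
          ({x : unitInterval | decide (x < α k (acks I)) = a} ×ˢ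
            {x : unitInterval | (v && decide ((x : ℝ) < m.succProb a)) = b})) := by
    ext s
    simp only [drawOutcome, drawArrival, drawSched, drawAttack, Set.mem_ofPred_eq, Prod.mk.injEq,
      true_and, Set.mem_prod, Set.mem_univ]
    constructor
    · rintro ⟨rfl, rfl, h⟩
      exact ⟨rfl, rfl, h⟩
    · rintro ⟨rfl, rfl, h⟩
      exact ⟨rfl, rfl, h⟩
  rw [hset, Measure.prod_prod, Measure.prod_prod, Measure.prod_prod, measure_univ, one_mul,
    volume_decide_lt, volume_decide_lt, volume_channel hm,
    ENNReal.ofReal_mul (prob_nonneg _ _), ENNReal.ofReal_mul (prob_nonneg _ _)]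

theorem integrable_sched {m : Model nx nu ny} {pol : ControllerPolicy nx nu} {α : AttackPolicy}
    {k : ℕ} (g : Fin k → Bool) (v : Bool) :
    Integrable (fun ω : Sample nx ny => if acks (m.loopState pol α k ω).1 = g then
      prob (pol.sched k (m.loopState pol α k ω).1) v else 0) m.law := by
  have hS : Measurable fun ω : Sample nx ny => pol.sched k (m.loopState pol α k ω).1 :=
    (pol.measurable_sched k).comp (m.measurable_loopState pol α k).fst
  have hp : Measurable fun q : unitInterval => prob q v := by
    cases v
    · exact measurable_const.sub measurable_subtype_coe
    · exact measurable_subtype_coe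
  refine Integrable.of_bound (Measurable.ite (m.measurable_acks_loopState pol α k
    (measurableSet_singleton g)) (hp.comp hS) measurable_const).aestronglyMeasurable 1
    (Filter.Eventually.of_forall fun ω => ?_)
  have h1 : ∀ q : unitInterval, prob q v ≤ 1 := fun q => by
    have h0 := q.2.1
    have h1 := q.2.2
    cases v <;> simp only [prob, Bool.false_eq_true, if_true, if_false] <;> linarith
  split_ifs
  · rw [Real.norm_of_nonneg (prob_nonneg _ _)]
    exact h1 _
  · simp

/-- The seeds of the stage are independent of the information, so the probability of an outcome
factors. -/
theorem law_outcome {m : Model nx nu ny} (hm : m.Valid) (g : Fin k → Bool) (v a b : Bool) :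
    m.law.real (m.outcome pol α k ⁻¹' {(g, v, a, b)}) =
      (∫ ω, (if acks (m.loopState pol α k ω).1 = g then
        prob (pol.sched k (m.loopState pol α k ω).1) v else 0) ∂m.law)
          * (prob (α k g) a * m.channel v a b) := by
  have hc : 0 ≤ prob (α k g) a * m.channel v a b :=
    mul_nonneg (prob_nonneg _ _) (channel_nonneg hm _ _ _)
  have hO : Measurable fun p : LoopState nx nu k × Seeds =>
      m.drawOutcome pol α k p.1.1 p.2 :=
    (m.measurable_drawOutcome pol α k).comp (measurable_fst.fst.prodMk measurable_snd)
  have hΦ : Measurable fun p : LoopState nx nu k × Seeds =>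
      ({(g, v, a, b)} : Set (Outcome k)).indicator (fun _ => (1 : ENNReal))
        (m.drawOutcome pol α k p.1.1 p.2) :=
    (measurable_const.indicator (measurableSet_singleton _)).comp hO
  have h1 := lintegral_loopState_seeds hm pol α k hΦ
  have h2 : ∫⁻ ω, ({(g, v, a, b)} : Set (Outcome k)).indicator (fun _ => (1 : ENNReal))
      (m.outcome pol α k ω) ∂m.law = m.law (m.outcome pol α k ⁻¹' {(g, v, a, b)}) :=
    lintegral_indicator_one (m.measurable_outcome pol α k (measurableSet_singleton (g, v, a, b)))
  have h3 : ∀ I : Info nx nu k, ∫⁻ s, ∫⁻ _y : (Fin nx → ℝ) × (Fin nx → ℝ),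
      ({(g, v, a, b)} : Set (Outcome k)).indicator (fun _ => (1 : ENNReal))
        (m.drawOutcome pol α k I s) ∂m.errLaw (m.hold I) ∂seedLaw =
      ENNReal.ofReal ((if acks I = g then prob (pol.sched k I) v else 0)
        * (prob (α k g) a * m.channel v a b)) := by
    intro I
    simp only [lintegral_const, measure_univ, mul_one]
    have hI : Measurable fun s => m.drawOutcome pol α k I s :=
      (m.measurable_drawOutcome pol α k).comp measurable_prodMk_left
    have h4 : ∫⁻ s, ({(g, v, a, b)} : Set (Outcome k)).indicator (fun _ => (1 : ENNReal))
        (m.drawOutcome pol α k I s) ∂seedLaw =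
        seedLaw {s | m.drawOutcome pol α k I s = (g, v, a, b)} :=
      lintegral_indicator_one (hI (measurableSet_singleton (g, v, a, b)))
    rw [h4]
    split_ifs with hg
    · subst hg
      exact seedLaw_drawOutcome pol α k hm I v a b
    · have : {s | m.drawOutcome pol α k I s = (g, v, a, b)} = ∅ := by
        ext s
        simp only [drawOutcome, Set.mem_ofPred_eq, Prod.mk.injEq, Set.mem_empty_iff_false,
          iff_false]
        exact fun h => hg h.1
      rw [this, measure_empty, zero_mul, ENNReal.ofReal_zero]
  have hnn : ∀ I : Info nx nu k, 0 ≤ (if acks I = g then prob (pol.sched k I) v else 0)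
      * (prob (α k g) a * m.channel v a b) := fun I =>
    mul_nonneg (by split_ifs; exacts [prob_nonneg _ _, le_rfl]) hc
  rw [measureReal_def, ← h2, ← integral_mul_const]
  have h5 := h1
  simp only [h3] at h5
  rw [← ofReal_integral_eq_lintegral_ofReal ((integrable_sched g v).mul_const _)
    (Filter.Eventually.of_forall fun ω => hnn _)] at h5
  exact (congrArg ENNReal.toReal h5).trans
    (ENNReal.toReal_ofReal (integral_nonneg fun ω => hnn _))

end Outcome

/-- A scheduling rule on acknowledgment histories describes the scheduling of a strategy if it
gives the conditional probabilities of `ν_k = 1` given the acknowledgments. -/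
def Describes (m : Model nx nu ny) (pol : ControllerPolicy nx nu) (α : AttackPolicy)
    (r : AttackPolicy) : Prop :=
  ∀ k g, ∫ ω, (if acks (m.loopState pol α k ω).1 = g then
      (pol.sched k (m.loopState pol α k ω).1 : ℝ) else 0) ∂m.law =
    m.law.real {ω | acks (m.loopState pol α k ω).1 = g} * (r k g : ℝ)

theorem integral_indicator_acks (m : Model nx nu ny) (pol : ControllerPolicy nx nu)
    (α : AttackPolicy) (k : ℕ) (g : Fin k → Bool) (c : ℝ) :
    ∫ ω, (if acks (m.loopState pol α k ω).1 = g then c else 0) ∂m.law =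
      m.law.real {ω | acks (m.loopState pol α k ω).1 = g} * c := by
  have h := integral_indicator_const (μ := m.law) c
    (m.measurable_acks_loopState pol α k (measurableSet_singleton g))
  refine Eq.trans (integral_congr_ae (Filter.Eventually.of_forall fun ω => ?_)) h
  simp [Set.indicator]

/-- The conditional probabilities given the acknowledgments describe the scheduling; on histories of
probability zero the quotient is `0` and the value is irrelevant. -/
theorem exists_describes (m : Model nx nu ny) (pol : ControllerPolicy nx nu) (α : AttackPolicy) :
    ∃ r, m.Describes pol α r := by
  have hb : ∀ k g, 0 ≤ (∫ ω, (if acks (m.loopState pol α k ω).1 = g then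
      (pol.sched k (m.loopState pol α k ω).1 : ℝ) else 0) ∂m.law) ∧
      (∫ ω, (if acks (m.loopState pol α k ω).1 = g then
      (pol.sched k (m.loopState pol α k ω).1 : ℝ) else 0) ∂m.law) ≤
        m.law.real {ω | acks (m.loopState pol α k ω).1 = g} := by
    intro k g
    constructor
    · refine integral_nonneg fun ω => ?_
      dsimp only
      split_ifs
      exacts [(pol.sched k _).2.1, le_rfl]
    · rw [← mul_one (m.law.real _), ← integral_indicator_acks]
      refine integral_mono (integrable_sched g true)
        (integrable_comp_of_finite (m.measurable_acks_loopState pol α k)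
          fun h => if h = g then (1 : ℝ) else 0) fun ω => ?_
      dsimp only
      split_ifs
      exacts [(pol.sched k _).2.2, le_rfl]
  refine ⟨fun k g => ⟨(∫ ω, (if acks (m.loopState pol α k ω).1 = g then
      (pol.sched k (m.loopState pol α k ω).1 : ℝ) else 0) ∂m.law) /
        m.law.real {ω | acks (m.loopState pol α k ω).1 = g},
    div_nonneg (hb k g).1 measureReal_nonneg,
    div_le_one_of_le₀ (hb k g).2 measureReal_nonneg⟩, fun k g => ?_⟩
  by_cases h0 : m.law.real {ω | acks (m.loopState pol α k ω).1 = g} = 0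
  · rw [h0, zero_mul]
    exact le_antisymm ((hb k g).2.trans h0.le) (hb k g).1
  · exact (mul_div_cancel₀ _ h0).symm

theorem integral_sched_of_describes {m : Model nx nu ny} {pol : ControllerPolicy nx nu}
    {α r : AttackPolicy} (hr : m.Describes pol α r) (k : ℕ) (g : Fin k → Bool) (v : Bool) :
    ∫ ω, (if acks (m.loopState pol α k ω).1 = g then
      prob (pol.sched k (m.loopState pol α k ω).1) v else 0) ∂m.law =
    m.law.real {ω | acks (m.loopState pol α k ω).1 = g} * prob (r k g) v := by
  cases v with
  | true => exact hr k g
  | false =>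
    have h1 := integral_sub (integrable_comp_of_finite (μ := m.law)
      (m.measurable_acks_loopState pol α k) fun h => if h = g then (1 : ℝ) else 0)
      (integrable_sched (m := m) (pol := pol) (α := α) g true)
    have h2 := hr k g
    refine Eq.trans (integral_congr_ae (Filter.Eventually.of_forall fun ω => ?_)) (h1.trans ?_)
    · by_cases hg : acks (m.loopState pol α k ω).1 = g <;> simp [prob, hg]
    · rw [integral_indicator_acks]
      refine (congrArg _ h2).trans ?_
      simp only [prob, Bool.false_eq_true, if_false]
      ring

/-- Expectation over the decisions and the arrival, given the acknowledgments. -/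
def outcomeMean (m : Model nx nu ny) (r α : AttackPolicy) {k : ℕ} (F : Outcome k → ℝ)
    (g : Fin k → Bool) : ℝ :=
  ∑ v, ∑ a, prob (r k g) v * prob (α k g) a * ∑ b, m.channel v a b * F (g, v, a, b)

/-- Expectations of functions of the outcome depend on the scheduling strategy only through the
rule that describes it. -/
theorem integral_outcome {m : Model nx nu ny} (hm : m.Valid) {pol : ControllerPolicy nx nu}
    {α r : AttackPolicy} (hr : m.Describes pol α r) (k : ℕ) (F : Outcome k → ℝ) :
    ∫ ω, F (m.outcome pol α k ω) ∂m.law =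
      ∫ ω, m.outcomeMean r α F (acks (m.loopState pol α k ω).1) ∂m.law := by
  rw [integral_comp_eq_sum (m.measurable_outcome pol α k),
    integral_comp_eq_sum (m.measurable_acks_loopState pol α k), Fintype.sum_prod_type]
  refine Finset.sum_congr rfl fun g _ => ?_
  simp only [Fintype.sum_prod_type, law_outcome pol α k hm, integral_sched_of_describes hr,
    outcomeMean, Finset.mul_sum]
  refine Finset.sum_congr rfl fun v _ => Finset.sum_congr rfl fun a _ =>
    Finset.sum_congr rfl fun b _ => ?_
  have : m.law.real ((fun ω : Sample nx ny => acks (m.loopState pol α k ω).1) ⁻¹' {g}) =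
    m.law.real {ω | acks (m.loopState pol α k ω).1 = g} := rfl
  rw [this]
  ring

/-- Expected discounted cost over the stages `k, …, k + n - 1` of the game on acknowledgment
histories, starting from the history `g`. -/
def histCost (m : Model nx nu ny) (r α : AttackPolicy) : (n k : ℕ) → (Fin k → Bool) → ℝ
  | 0, _, _ => 0
  | n + 1, k, g => m.outcomeMean r α (fun o => m.stageCost k
      (holdingTime m.t0 (k + 1) (Fin.snoc (α := fun _ => Bool) o.1 o.2.2.2)) o.2.1 o.2.2.1
        + m.eta * histCost m r α n (k + 1) (Fin.snoc (α := fun _ => Bool) o.1 o.2.2.2)) g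

/-- The realised cost of stage `k` in the reduced game. -/
def redStage (m : Model nx nu ny) (pol : ControllerPolicy nx nu) (α : AttackPolicy) (k : ℕ)
    (ω : Sample nx ny) : ℝ :=
  m.stageCost k (m.holdAt pol α k ω) (m.outcome pol α k ω).2.1 (m.outcome pol α k ω).2.2.1

theorem holdAt_eq (m : Model nx nu ny) (pol : ControllerPolicy nx nu) (α : AttackPolicy) (k : ℕ)
    (ω : Sample nx ny) : m.holdAt pol α k ω = holdingTime m.t0 (k + 1)
      (Fin.snoc (α := fun _ => Bool) (m.outcome pol α k ω).1 (m.outcome pol α k ω).2.2.2) := by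
  rw [holdAt, hold, acks_loopState_succ]

theorem integrable_redStage (m : Model nx nu ny) (pol : ControllerPolicy nx nu)
    (α : AttackPolicy) (k : ℕ) : Integrable (m.redStage pol α k) m.law := by
  have h := integrable_comp_of_finite (μ := m.law) (m.measurable_outcome pol α k)
    fun o => m.stageCost k (holdingTime m.t0 (k + 1)
      (Fin.snoc (α := fun _ => Bool) o.1 o.2.2.2)) o.2.1 o.2.2.1
  refine h.congr (Filter.Eventually.of_forall fun ω => ?_)
  simp only [redStage, holdAt_eq]

theorem integral_redStage_sum {m : Model nx nu ny} (hm : m.Valid) {pol : ControllerPolicy nx nu}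
    {α r : AttackPolicy} (hr : m.Describes pol α r) (n k : ℕ) :
    ∫ ω, ∑ j ∈ Finset.range n, m.eta ^ j * m.redStage pol α (k + j) ω ∂m.law =
      ∫ ω, m.histCost r α n k (acks (m.loopState pol α k ω).1) ∂m.law := by
  induction n generalizing k with
  | zero => simp [histCost]
  | succ n ih =>
    have hj : ∀ (i j : ℕ), Integrable (fun ω => m.eta ^ i * m.redStage pol α j ω) m.law :=
      fun i j => (m.integrable_redStage pol α j).const_mul _
    have h1 : ∀ ω : Sample nx ny, ∑ j ∈ Finset.range (n + 1),
        m.eta ^ j * m.redStage pol α (k + j) ω = m.redStage pol α k ω +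
          m.eta * ∑ j ∈ Finset.range n, m.eta ^ j * m.redStage pol α (k + 1 + j) ω := by
      intro ω
      rw [Finset.sum_range_succ', add_comm, Finset.mul_sum]
      congr 1
      · simp
      · refine Finset.sum_congr rfl fun j _ => ?_
        rw [pow_succ, show k + (j + 1) = k + 1 + j by omega]
        ring
    simp only [h1]
    rw [integral_add (m.integrable_redStage pol α k)
      ((integrable_finsetSum _ fun j _ => hj j (k + 1 + j)).const_mul _), integral_const_mul, ih,
      ← integral_const_mul, ← integral_add (m.integrable_redStage pol α k)
        ((integrable_comp_of_finite (m.measurable_acks_loopState pol α (k + 1)) _).const_mul _)]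
    refine Eq.trans ?_ (integral_outcome hm hr k _)
    refine integral_congr_ae (Filter.Eventually.of_forall fun ω => ?_)
    simp only [redStage, holdAt_eq, acks_loopState_succ]

end Model

namespace Model

/-- The cost of the game on acknowledgment histories, over all stages. -/
def histTotal (m : Model nx nu ny) (r α : AttackPolicy) : ℝ :=
  m.histCost r α (m.K + 1) 0 Fin.elim0

theorem integral_redStage_total {m : Model nx nu ny} (hm : m.Valid)
    {pol : ControllerPolicy nx nu} {α r : AttackPolicy} (hr : m.Describes pol α r) :
    ∫ ω, ∑ k ∈ Finset.range (m.K + 1), m.eta ^ k * m.redStage pol α k ω ∂m.law =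
      m.histTotal r α := by
  have h := integral_redStage_sum hm hr (m.K + 1) 0
  simp only [zero_add] at h
  rw [h]
  have : ∀ ω : Sample nx ny, acks (m.loopState pol α 0 ω).1 = Fin.elim0 :=
    fun ω => funext fun i => i.elim0
  simp only [this, integral_const, probReal_univ, one_smul]
  rfl

theorem redStage_eq {m : Model nx nu ny} (hm : m.Valid) (pol : ControllerPolicy nx nu)
    (α : AttackPolicy) {k : ℕ} (hk : k ≤ m.K) (ω : Sample nx ny) :
    m.redStage pol α k ω = m.errCost k (m.holdAt pol α k ω) +
      m.commCost ((m.run pol α ω k).sched pol ω) ((m.run pol α ω k).attack α ω) := by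
  rw [run_sched_eq, run_attack_eq, redStage, stageCost, hm.errWeight_eq hk]
  rfl

theorem integrable_errCost (m : Model nx nu ny) (pol : ControllerPolicy nx nu)
    (α : AttackPolicy) (k : ℕ) :
    Integrable (fun ω => m.errCost k (m.holdAt pol α k ω)) m.law :=
  integrable_comp_of_finite (m.measurable_acks_loopState pol α (k + 1))
    fun g => m.errCost k (holdingTime m.t0 (k + 1) g)

theorem integrable_commCost (m : Model nx nu ny) (pol : ControllerPolicy nx nu)
    (α : AttackPolicy) (k : ℕ) :
    Integrable (fun ω => m.commCost ((m.run pol α ω k).sched pol ω)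
      ((m.run pol α ω k).attack α ω)) m.law := by
  simp only [run_sched_eq, run_attack_eq]
  exact integrable_comp_of_finite (m.measurable_outcome pol α k) fun o => m.commCost o.2.1 o.2.2.1

theorem lintegral_quadCost_eq {m : Model nx nu ny} (hm : m.Valid) (pol : ControllerPolicy nx nu)
    (α : AttackPolicy) :
    0 ≤ m.baseCost + ∑ k ∈ Finset.range (m.K + 1),
        m.eta ^ k * ∫ ω, m.errCost k (m.holdAt pol α k ω) ∂m.law ∧
    ∫⁻ ω, ENNReal.ofReal (m.quadCost pol α ω) ∂m.law = m.totalDeviation pol α +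
      ENNReal.ofReal (m.baseCost + ∑ k ∈ Finset.range (m.K + 1),
        m.eta ^ k * ∫ ω, m.errCost k (m.holdAt pol α k ω) ∂m.law) := by
  have hη := hm.eta_pos.le
  have p0 := trace_mul_nonneg (hm.posSemidef_S (Nat.zero_le _))
    (hm.hSig0.add (hm.posSemidef_iterate_f (m.t0 + 1)))
  have p1 : ∀ k ∈ Finset.range (m.K + 1), 0 ≤ m.eta ^ (k + 1) * trace (m.S (k + 1) * m.Q) :=
    fun k hk => mul_nonneg (pow_nonneg hη _) (trace_mul_nonneg
      (hm.posSemidef_S (Finset.mem_range.mp hk)) hm.hQ.posSemidef)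
  have p2 : ∀ k ∈ Finset.range (m.K + 1),
      0 ≤ m.eta ^ k * ∫ ω, m.errCost k (m.holdAt pol α k ω) ∂m.law :=
    fun k hk => mul_nonneg (pow_nonneg hη _) (integral_nonneg fun ω =>
      errCost_nonneg hm (Nat.lt_succ_iff.mp (Finset.mem_range.mp hk)) _)
  refine ⟨add_nonneg (add_nonneg p0 (Finset.sum_nonneg p1)) (Finset.sum_nonneg p2), ?_⟩
  rw [lintegral_quadCost hm, sum_stageQuad_add hm pol α le_rfl, stateQuad_zero hm, baseCost,
    ENNReal.ofReal_add (add_nonneg p0 (Finset.sum_nonneg p1)) (Finset.sum_nonneg p2),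
    ENNReal.ofReal_add p0 (Finset.sum_nonneg p1), ENNReal.ofReal_sum_of_nonneg p1,
    ENNReal.ofReal_sum_of_nonneg p2, totalDeviation]
  simp only [mul_add, Finset.sum_add_distrib]
  have e1 : ∀ k ∈ Finset.range (m.K + 1), ENNReal.ofReal m.eta ^ k *
      ENNReal.ofReal (m.eta * trace (m.S (k + 1) * m.Q)) =
        ENNReal.ofReal (m.eta ^ (k + 1) * trace (m.S (k + 1) * m.Q)) := fun k _ => by
    rw [← ENNReal.ofReal_pow hη, ← ENNReal.ofReal_mul (pow_nonneg hη _), pow_succ, mul_assoc]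
  have e2 : ∀ k ∈ Finset.range (m.K + 1), ENNReal.ofReal m.eta ^ k *
      ∫⁻ ω, ENNReal.ofReal (m.errCost k (m.holdAt pol α k ω)) ∂m.law =
        ENNReal.ofReal (m.eta ^ k * ∫ ω, m.errCost k (m.holdAt pol α k ω) ∂m.law) :=
    fun k hk => by
      rw [ENNReal.ofReal_mul (pow_nonneg hη _), ENNReal.ofReal_pow hη,
        ofReal_integral_eq_lintegral_ofReal (m.integrable_errCost pol α k)
          (Filter.Eventually.of_forall fun ω =>
            errCost_nonneg hm (Nat.lt_succ_iff.mp (Finset.mem_range.mp hk)) _)]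
  rw [Finset.sum_congr rfl e1, Finset.sum_congr rfl e2]
  simp only [add_assoc, add_comm, add_left_comm]

/-- The cost decomposition: the deviation from the linear control, plus a constant, plus the
cost of the game on acknowledgment histories. It holds also when the cost is infinite. -/
theorem J_eq {m : Model nx nu ny} (hm : m.Valid) {pol : ControllerPolicy nx nu}
    {α r : AttackPolicy} (hr : m.Describes pol α r) :
    m.J pol α = (((m.K : ℝ)⁻¹ : ℝ) : EReal) * ((m.totalDeviation pol α : EReal)
      + ((m.baseCost + m.histTotal r α : ℝ) : EReal)) := by
  obtain ⟨h0, h1⟩ := lintegral_quadCost_eq hm pol α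
  have h2 : m.histTotal r α = (∑ k ∈ Finset.range (m.K + 1),
        m.eta ^ k * ∫ ω, m.errCost k (m.holdAt pol α k ω) ∂m.law) +
      ∫ ω, ∑ k ∈ Finset.range (m.K + 1), m.eta ^ k *
          m.commCost ((m.run pol α ω k).sched pol ω) ((m.run pol α ω k).attack α ω) ∂m.law := by
    simp only [← integral_const_mul]
    rw [← integral_redStage_total hm hr,
      ← integral_finsetSum _ fun k _ => (m.integrable_errCost pol α k).const_mul _,
      ← integral_add (integrable_finsetSum _ fun k _ =>
        (m.integrable_errCost pol α k).const_mul _) (integrable_finsetSum _ fun k _ =>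
        (m.integrable_commCost pol α k).const_mul _)]
    refine integral_congr_ae (Filter.Eventually.of_forall fun ω => ?_)
    simp only [← Finset.sum_add_distrib, ← mul_add]
    exact Finset.sum_congr rfl fun k hk => by
      rw [redStage_eq hm pol α (Nat.lt_succ_iff.mp (Finset.mem_range.mp hk))]
  rw [J, h1, EReal.coe_ennreal_add, EReal.coe_ennreal_ofReal, max_eq_left h0, add_assoc,
    ← EReal.coe_add, h2, add_assoc m.baseCost]

/-! ### The linear control -/

/-- The strategy that schedules by a rule on acknowledgment histories and applies the linear
control. -/
def linear (m : Model nx nu ny) (r : AttackPolicy) : ControllerPolicy nx nu where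
  sched k I := r k (acks I)
  input k I o _ := -(m.L k *ᵥ m.estimate k I o)
  measurable_sched k := (measurable_of_finite (r k)).comp measurable_acks
  measurable_input := (m.separated fun _ _ => 0).measurable_input

theorem separated_eq_linear (m : Model nx nu ny) (σ : HoldingPolicy) :
    m.separated σ = m.linear (σ.toAttack m.t0) := rfl

theorem describes_linear (m : Model nx nu ny) (r α : AttackPolicy) :
    m.Describes (m.linear r) α r := by
  intro k g
  rw [← integral_indicator_acks]
  refine integral_congr_ae (Filter.Eventually.of_forall fun ω => ?_)
  dsimp only
  split_ifs with h
  · rw [← h]; rfl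
  · rfl

theorem totalDeviation_linear (m : Model nx nu ny) (r α : AttackPolicy) :
    m.totalDeviation (m.linear r) α = 0 := by
  refine Finset.sum_eq_zero fun k _ => ?_
  have h : ∀ ω : Sample nx ny, m.inputAt (m.linear r) α k ω +
      m.L k *ᵥ m.estimateAt (m.linear r) α k ω = 0 := fun ω => neg_add_cancel _
  simp [deviation, h, quad]

/-- The affine map that takes the cost of the game on acknowledgment histories to the cost of the
full game. -/
def scale (m : Model nx nu ny) (c : ℝ) : ℝ := (m.K : ℝ)⁻¹ * (m.baseCost + c)

theorem inv_K_pos {m : Model nx nu ny} (hm : m.Valid) : 0 < (m.K : ℝ)⁻¹ :=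
  inv_pos.mpr (Nat.cast_pos.mpr hm.hK)

theorem scale_le_scale {m : Model nx nu ny} (hm : m.Valid) {c d : ℝ} :
    ((m.scale c : ℝ) : EReal) ≤ (m.scale d : ℝ) ↔ c ≤ d := by
  rw [EReal.coe_le_coe_iff, scale, scale, mul_le_mul_iff_right₀ (inv_K_pos hm),
    add_le_add_iff_left]

theorem J_linear {m : Model nx nu ny} (hm : m.Valid) (r α : AttackPolicy) :
    m.J (m.linear r) α = (m.scale (m.histTotal r α) : ℝ) := by
  rw [J_eq hm (m.describes_linear r α), totalDeviation_linear, EReal.coe_ennreal_zero, zero_add,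
    ← EReal.coe_mul, scale]

theorem scale_le_J {m : Model nx nu ny} (hm : m.Valid) {pol : ControllerPolicy nx nu}
    {α r : AttackPolicy} (hr : m.Describes pol α r) :
    ((m.scale (m.histTotal r α) : ℝ) : EReal) ≤ m.J pol α := by
  rw [J_eq hm hr, scale, EReal.coe_mul]
  refine mul_le_mul_of_nonneg_left ?_ (EReal.coe_nonneg.mpr (inv_K_pos hm).le)
  exact le_add_of_nonneg_left (EReal.coe_ennreal_nonneg _)

/-- A strategy that is no worse than the linear control with the same scheduling has no
deviation cost. -/
theorem totalDeviation_eq_zero {m : Model nx nu ny} (hm : m.Valid)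
    {pol : ControllerPolicy nx nu} {α r : AttackPolicy} (hr : m.Describes pol α r)
    (h : m.J pol α ≤ m.J (m.linear r) α) : m.totalDeviation pol α = 0 := by
  rw [J_linear hm, J_eq hm hr, scale] at h
  have hpos := inv_K_pos hm
  induction hD : m.totalDeviation pol α with
  | top =>
    rw [hD, EReal.coe_ennreal_top, EReal.top_add_coe, EReal.coe_mul_top_of_pos hpos] at h
    exact absurd h (not_le.mpr (EReal.coe_lt_top _))
  | coe d =>
    rw [hD, ← ENNReal.ofReal_coe_nnreal, EReal.coe_ennreal_ofReal, max_eq_left d.coe_nonneg,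
      ← EReal.coe_add, ← EReal.coe_mul, EReal.coe_le_coe_iff,
      mul_le_mul_iff_right₀ hpos] at h
    have : (d : ℝ) = 0 := le_antisymm (by linarith) d.coe_nonneg
    simpa using this

theorem input_eq_of_totalDeviation_eq_zero {m : Model nx nu ny} (hm : m.Valid)
    {pol : ControllerPolicy nx nu} {α : AttackPolicy} (h : m.totalDeviation pol α = 0) {k : ℕ}
    (hk : k ≤ m.K) :
    ∀ᵐ ω ∂m.law, m.inputAt pol α k ω = -(m.L k *ᵥ m.estimateAt pol α k ω) := by
  have hM := hm.posDef_gainWeight hk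
  have h1 := (Finset.sum_eq_zero_iff.mp h) k (Finset.mem_range.mpr (Nat.lt_succ_of_le hk))
  have h2 : m.deviation pol α k = 0 := (mul_eq_zero.mp h1).resolve_left
    (pow_ne_zero _ (ENNReal.ofReal_pos.mpr hm.eta_pos).ne')
  have hmeas : Measurable fun ω : Sample nx ny => ENNReal.ofReal (quad (m.gainWeight k)
      (m.inputAt pol α k ω + m.L k *ᵥ m.estimateAt pol α k ω)) :=
    (measurable_quad_comp _ ((m.measurable_inputAt pol α k).add
      (measurable_mulVec_comp _ (m.measurable_estimateAt pol α k)))).ennreal_ofReal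
  filter_upwards [(lintegral_eq_zero_iff hmeas).mp h2] with ω hω
  have h3 : quad (m.gainWeight k)
      (m.inputAt pol α k ω + m.L k *ᵥ m.estimateAt pol α k ω) = 0 :=
    le_antisymm (ENNReal.ofReal_eq_zero.mp hω) (quad_nonneg hM.posSemidef _)
  exact eq_neg_of_add_eq_zero_left (quad_eq_zero hM h3)

end Model

/-! ### Backward induction in the reduced game -/

/-- The minimax theorem for the mixed extension of a game with two actions for each player, where
each player may be restricted to an interval of mixed actions. -/
theorem exists_saddle_two_by_two (c : Bool → Bool → ℝ) {X Y : Set ℝ} (hX : Convex ℝ X)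
    (hXc : IsCompact X) (hXn : X.Nonempty) (hY : Convex ℝ Y) (hYc : IsCompact Y)
    (hYn : Y.Nonempty) :
    ∃ p ∈ X, ∃ q ∈ Y, ∀ x ∈ X, ∀ y ∈ Y,
      p * (y * c true true + (1 - y) * c true false)
          + (1 - p) * (y * c false true + (1 - y) * c false false) ≤
        x * (q * c true true + (1 - q) * c true false)
          + (1 - x) * (q * c false true + (1 - q) * c false false) := by
  refine Sion.exists_isSaddlePointOn (f := fun x y =>
    x * (y * c true true + (1 - y) * c true false)
      + (1 - x) * (y * c false true + (1 - y) * c false false)) hXn hX hXc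
    (fun y _ => Continuous.lowerSemicontinuous (by fun_prop) |>.lowerSemicontinuousOn _)
    (fun y _ => ConvexOn.quasiconvexOn ⟨hX, fun a _ b _ s t _ _ hst => ?_⟩) hY hYn hYc
    (fun x _ => Continuous.upperSemicontinuous (by fun_prop) |>.upperSemicontinuousOn _)
    (fun x _ => ConcaveOn.quasiconcaveOn ⟨hY, fun a _ b _ s t _ _ hst => ?_⟩)
  · obtain rfl : t = 1 - s := by linarith
    simp only [smul_eq_mul]
    exact le_of_eq (by ring)
  · obtain rfl : t = 1 - s := by linarith
    simp only [smul_eq_mul]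
    exact le_of_eq (by ring)

namespace Model

theorem outcomeMean_eq (m : Model nx nu ny) (r α : AttackPolicy) {k : ℕ} (F : Outcome k → ℝ)
    (g : Fin k → Bool) : m.outcomeMean r α F g =
      (r k g : ℝ) * ((α k g : ℝ) * (∑ b, m.channel true true b * F (g, true, true, b))
          + (1 - (α k g : ℝ)) * (∑ b, m.channel true false b * F (g, true, false, b)))
        + (1 - (r k g : ℝ)) * ((α k g : ℝ) * (∑ b, m.channel false true b * F (g, false, true, b))
          + (1 - (α k g : ℝ)) * (∑ b, m.channel false false b * F (g, false, false, b))) := by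
  simp only [outcomeMean, prob, Fintype.sum_bool, if_true, Bool.false_eq_true, if_false]
  ring

theorem outcomeMean_mono {m : Model nx nu ny} (hm : m.Valid) (r α : AttackPolicy) {k : ℕ}
    {F G : Outcome k → ℝ} (g : Fin k → Bool) (h : ∀ v a b, F (g, v, a, b) ≤ G (g, v, a, b)) :
    m.outcomeMean r α F g ≤ m.outcomeMean r α G g :=
  Finset.sum_le_sum fun v _ => Finset.sum_le_sum fun a _ => mul_le_mul_of_nonneg_left
    (Finset.sum_le_sum fun b _ => mul_le_mul_of_nonneg_left (h v a b) (channel_nonneg hm v a b))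
    (mul_nonneg (prob_nonneg _ _) (prob_nonneg _ _))

theorem histCost_congr (m : Model nx nu ny) {r r' α α' : AttackPolicy} (n : ℕ) {k : ℕ}
    (hr : ∀ j, k ≤ j → r j = r' j) (hα : ∀ j, k ≤ j → α j = α' j) (g : Fin k → Bool) :
    m.histCost r α n k g = m.histCost r' α' n k g := by
  induction n generalizing k with
  | zero => rfl
  | succ n ih =>
    simp only [histCost, outcomeMean, hr k le_rfl, hα k le_rfl,
      ih (fun j hj => hr j (Nat.le_of_succ_le hj)) (fun j hj => hα j (Nat.le_of_succ_le hj))]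

/-- Between holding-time strategies, the game on acknowledgment histories is the Markov game. -/
theorem histCost_toAttack (m : Model nx nu ny) (σ α : HoldingPolicy) (n : ℕ) {k : ℕ}
    (g : Fin k → Bool) : m.histCost (σ.toAttack m.t0) (α.toAttack m.t0) n k g =
      m.costToGo σ α n k (holdingTime m.t0 k g) := by
  induction n generalizing k with
  | zero => rfl
  | succ n ih =>
    simp only [histCost, outcomeMean, costToGo, ih, holdingTime_snoc, HoldingPolicy.toAttack]
    refine Finset.sum_congr rfl fun v _ => Finset.sum_congr rfl fun a _ => ?_
    rw [Finset.sum_pair (Nat.succ_ne_zero _).symm]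
    simp [trans, channel, arrivalProb]

theorem histTotal_toAttack (m : Model nx nu ny) (σ α : HoldingPolicy) :
    m.histTotal (σ.toAttack m.t0) (α.toAttack m.t0) = m.Jred σ α :=
  m.histCost_toAttack σ α (m.K + 1) Fin.elim0

/-- A family of intervals of mixed actions, indexed by the stage and the holding time. -/
structure ActionFamily (P : ℕ → ℕ → Set ℝ) : Prop where
  convex : ∀ k t, Convex ℝ (P k t)
  isCompact : ∀ k t, IsCompact (P k t)
  nonempty : ∀ k t, (P k t).Nonempty
  subset : ∀ k t, P k t ⊆ Set.Icc 0 1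

/-- Backward induction. Each player is restricted to mixed actions from a given family; there are
holding-time strategies that form a saddle point at every history even against strategies that
use the whole history of acknowledgments. -/
theorem exists_saddle_histCost {m : Model nx nu ny} (hm : m.Valid) {P D : ℕ → ℕ → Set ℝ}
    (hP : ActionFamily P) (hD : ActionFamily D) (n k : ℕ) :
    ∃ σ α : HoldingPolicy, (∀ j t, (σ j t : ℝ) ∈ P j t) ∧ (∀ j t, (α j t : ℝ) ∈ D j t) ∧
      ∀ g : Fin k → Bool,
        (∀ a : AttackPolicy, (∀ j h, (a j h : ℝ) ∈ D j (holdingTime m.t0 j h)) →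
          m.histCost (σ.toAttack m.t0) a n k g ≤ m.costToGo σ α n k (holdingTime m.t0 k g)) ∧
        (∀ r : AttackPolicy, (∀ j h, (r j h : ℝ) ∈ P j (holdingTime m.t0 j h)) →
          m.costToGo σ α n k (holdingTime m.t0 k g) ≤
            m.histCost r (α.toAttack m.t0) n k g) := by
  induction n generalizing k with
  | zero =>
    choose p hp using hP.nonempty
    choose q hq using hD.nonempty
    exact ⟨fun j t => ⟨p j t, hP.subset j t (hp j t)⟩, fun j t => ⟨q j t, hD.subset j t (hq j t)⟩,
      hp, hq, fun g => ⟨fun a _ => le_rfl, fun r _ => le_rfl⟩⟩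
  | succ n ih =>
    obtain ⟨σ, α, hσ, hα, hsad⟩ := ih (k + 1)
    -- the value of the next stage as a function of the holding time
    let w : ℕ → ℝ := fun t => m.costToGo σ α n (k + 1) t
    let c : ℕ → Bool → Bool → ℝ := fun t v a => ∑ b, m.channel v a b *
      (m.stageCost k (if b then 0 else t + 1) v a + m.eta * w (if b then 0 else t + 1))
    have hsp := fun t => exists_saddle_two_by_two (c t) (hP.convex k t) (hP.isCompact k t)
      (hP.nonempty k t) (hD.convex k t) (hD.isCompact k t) (hD.nonempty k t)
    choose p hp q hq hpq using hsp
    let σ' : HoldingPolicy := fun j t =>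
      if j = k then ⟨p t, hP.subset k t (hp t)⟩ else σ j t
    let α' : HoldingPolicy := fun j t =>
      if j = k then ⟨q t, hD.subset k t (hq t)⟩ else α j t
    have hσk : ∀ t, (σ' k t : ℝ) = p t := fun t => by simp [σ']
    have hαk : ∀ t, (α' k t : ℝ) = q t := fun t => by simp [α']
    have hσj : ∀ j, k + 1 ≤ j → (σ'.toAttack m.t0) j = (σ.toAttack m.t0) j := fun j hj =>
      funext fun g => if_neg (Nat.ne_of_gt hj)
    have hαj : ∀ j, k + 1 ≤ j → (α'.toAttack m.t0) j = (α.toAttack m.t0) j := fun j hj =>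
      funext fun g => if_neg (Nat.ne_of_gt hj)
    -- the one-stage payoff when the continuation is worth `w`
    let F : Outcome k → ℝ := fun o => m.stageCost k
      (holdingTime m.t0 (k + 1) (Fin.snoc (α := fun _ => Bool) o.1 o.2.2.2)) o.2.1 o.2.2.1
        + m.eta * w (holdingTime m.t0 (k + 1) (Fin.snoc (α := fun _ => Bool) o.1 o.2.2.2))
    have hF : ∀ (r a : AttackPolicy) (g : Fin k → Bool), m.outcomeMean r a F g =
        (r k g : ℝ) * ((a k g : ℝ) * c (holdingTime m.t0 k g) true true
            + (1 - (a k g : ℝ)) * c (holdingTime m.t0 k g) true false)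
          + (1 - (r k g : ℝ)) * ((a k g : ℝ) * c (holdingTime m.t0 k g) false true
            + (1 - (a k g : ℝ)) * c (holdingTime m.t0 k g) false false) := by
      intro r a g
      rw [outcomeMean_eq]
      simp only [F, c, holdingTime_snoc]
    have hval : ∀ g : Fin k → Bool, m.costToGo σ' α' (n + 1) k (holdingTime m.t0 k g) =
        m.outcomeMean (σ'.toAttack m.t0) (α'.toAttack m.t0) F g := by
      intro g
      rw [← histCost_toAttack, histCost]
      simp only [histCost_congr m n hσj hαj, histCost_toAttack]
      rfl
    refine ⟨σ', α', fun j t => ?_, fun j t => ?_, fun g => ⟨fun a ha => ?_, fun r hr => ?_⟩⟩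
    · by_cases h : j = k
      · subst h; rw [hσk]; exact hp t
      · simpa [σ', h] using hσ j t
    · by_cases h : j = k
      · subst h; rw [hαk]; exact hq t
      · simpa [α', h] using hα j t
    · have h1 : m.histCost (σ'.toAttack m.t0) a (n + 1) k g ≤
          m.outcomeMean (σ'.toAttack m.t0) a F g := by
        rw [histCost]
        refine outcomeMean_mono hm _ _ g fun v b b' => ?_
        have h2 := (hsad (Fin.snoc (α := fun _ => Bool) g b')).1 a ha
        rw [← histCost_congr m (α := a) n hσj fun _ _ => rfl] at h2
        exact add_le_add_right (mul_le_mul_of_nonneg_left h2 hm.eta_pos.le) _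
      refine h1.trans ?_
      rw [hval, hF, hF]
      have h3 := hpq (holdingTime m.t0 k g) (p _) (hp _) (a k g) (ha k g)
      simp only [HoldingPolicy.toAttack, hσk, hαk]
      exact h3
    · have h1 : m.outcomeMean r (α'.toAttack m.t0) F g ≤
          m.histCost r (α'.toAttack m.t0) (n + 1) k g := by
        rw [histCost]
        refine outcomeMean_mono hm _ _ g fun v b b' => ?_
        have h2 := (hsad (Fin.snoc (α := fun _ => Bool) g b')).2 r hr
        rw [← histCost_congr m (r := r) n (fun _ _ => rfl) hαj] at h2
        exact add_le_add_right (mul_le_mul_of_nonneg_left h2 hm.eta_pos.le) _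
      refine le_trans ?_ h1
      rw [hval, hF, hF]
      have h3 := hpq (holdingTime m.t0 k g) (r k g) (hr k g) (q _) (hq _)
      simp only [HoldingPolicy.toAttack, hσk, hαk]
      exact h3

theorem actionFamily_Icc : ActionFamily fun _ _ => Set.Icc 0 1 :=
  ⟨fun _ _ => convex_Icc 0 1, fun _ _ => isCompact_Icc, fun _ _ => ⟨0, by simp⟩,
    fun _ _ => subset_rfl⟩

theorem actionFamily_singleton (σ : HoldingPolicy) :
    ActionFamily fun k t => {(σ k t : ℝ)} :=
  ⟨fun _ _ => convex_singleton _, fun _ _ => isCompact_singleton, fun _ _ => ⟨_, rfl⟩,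
    fun k t => Set.singleton_subset_iff.mpr (σ k t).2⟩

/-- A saddle point of the reduced game, also against strategies that use the whole history. -/
theorem exists_saddle_histTotal {m : Model nx nu ny} (hm : m.Valid) :
    ∃ σ α : HoldingPolicy, (∀ a, m.histTotal (σ.toAttack m.t0) a ≤ m.Jred σ α) ∧
      ∀ r, m.Jred σ α ≤ m.histTotal r (α.toAttack m.t0) := by
  obtain ⟨σ, α, -, -, h⟩ :=
    exists_saddle_histCost hm actionFamily_Icc actionFamily_Icc (m.K + 1) 0
  exact ⟨σ, α, fun a => (h Fin.elim0).1 a fun j g => (a j g).2,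
    fun r => (h Fin.elim0).2 r fun j g => (r j g).2⟩

/-- Against a holding-time scheduling rule the attacker has a best response in the holding
time. -/
theorem exists_best_attack {m : Model nx nu ny} (hm : m.Valid) (σ : HoldingPolicy) :
    ∃ α : HoldingPolicy, ∀ a, m.histTotal (σ.toAttack m.t0) a ≤ m.Jred σ α := by
  obtain ⟨σ', α, hσ, -, h⟩ :=
    exists_saddle_histCost hm (actionFamily_singleton σ) actionFamily_Icc (m.K + 1) 0
  obtain rfl : σ' = σ := funext fun j => funext fun t => Subtype.ext (hσ j t)
  exact ⟨α, fun a => (h Fin.elim0).1 a fun j g => (a j g).2⟩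

/-- Against a holding-time attack the controller has a best scheduling rule in the holding
time. -/
theorem exists_best_sched {m : Model nx nu ny} (hm : m.Valid) (α : HoldingPolicy) :
    ∃ σ : HoldingPolicy, ∀ r, m.Jred σ α ≤ m.histTotal r (α.toAttack m.t0) := by
  obtain ⟨σ, α', -, hα, h⟩ :=
    exists_saddle_histCost hm actionFamily_Icc (actionFamily_singleton α) (m.K + 1) 0
  obtain rfl : α' = α := funext fun j => funext fun t => Subtype.ext (hα j t)
  exact ⟨σ, fun r => (h Fin.elim0).2 r fun j g => (r j g).2⟩

/-! ### Solutions of the two games -/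

theorem J_separated {m : Model nx nu ny} (hm : m.Valid) (σ : HoldingPolicy) (a : AttackPolicy) :
    m.J (m.separated σ) a = (m.scale (m.histTotal (σ.toAttack m.t0) a) : ℝ) := by
  rw [separated_eq_linear, J_linear hm]

theorem J_separated_toAttack {m : Model nx nu ny} (hm : m.Valid) (σ α : HoldingPolicy) :
    m.J (m.separated σ) (α.toAttack m.t0) = (m.scale (m.Jred σ α) : ℝ) := by
  rw [J_separated hm, histTotal_toAttack]

theorem le_J_of_forall_le {m : Model nx nu ny} (hm : m.Valid) {a : AttackPolicy} {c : ℝ}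
    (h : ∀ r, c ≤ m.histTotal r a) (pol : ControllerPolicy nx nu) :
    ((m.scale c : ℝ) : EReal) ≤ m.J pol a := by
  obtain ⟨r, hr⟩ := m.exists_describes pol a
  exact ((scale_le_scale hm).mpr (h r)).trans (scale_le_J hm hr)

/-- The worst case of a scheduling rule is the same in both games. -/
theorem exists_worst_case {m : Model nx nu ny} (hm : m.Valid) (σ : HoldingPolicy) :
    ∃ c : ℝ, (⨆ α, (m.Jred σ α : EReal)) = c ∧ (⨆ a, m.J (m.separated σ) a) = (m.scale c : ℝ) := by
  obtain ⟨α, hα⟩ := exists_best_attack hm σ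
  refine ⟨m.Jred σ α, le_antisymm (iSup_le fun α' => ?_) (le_iSup_of_le α le_rfl),
    le_antisymm (iSup_le fun a => ?_) ?_⟩
  · rw [EReal.coe_le_coe_iff, ← histTotal_toAttack]
    exact hα _
  · rw [J_separated hm, scale_le_scale hm]
    exact hα a
  · exact le_iSup_of_le (α.toAttack m.t0) (J_separated_toAttack hm σ α).ge

/-- The best case of an attack rule is the same in both games. -/
theorem exists_best_case {m : Model nx nu ny} (hm : m.Valid) (α : HoldingPolicy) :
    ∃ c : ℝ, (⨅ σ, (m.Jred σ α : EReal)) = c ∧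
      (⨅ pol, m.J pol (α.toAttack m.t0)) = (m.scale c : ℝ) := by
  obtain ⟨σ, hσ⟩ := exists_best_sched hm α
  refine ⟨m.Jred σ α, le_antisymm (iInf_le_of_le σ le_rfl) (le_iInf fun σ' => ?_),
    le_antisymm ?_ (le_iInf fun pol => le_J_of_forall_le hm hσ pol)⟩
  · rw [EReal.coe_le_coe_iff, ← histTotal_toAttack m σ']
    exact hσ _
  · exact iInf_le_of_le (m.separated σ) (J_separated_toAttack hm σ α).le

theorem isNash_iff {m : Model nx nu ny} (hm : m.Valid) (σ α : HoldingPolicy) :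
    IsNash m.J (m.separated σ) (α.toAttack m.t0) ↔
      IsNash (fun σ α => (m.Jred σ α : EReal)) σ α := by
  constructor
  · rintro ⟨h1, h2⟩
    refine ⟨fun α' => ?_, fun σ' => ?_⟩
    · have := h1 (α'.toAttack m.t0)
      rwa [J_separated_toAttack hm, J_separated_toAttack hm, scale_le_scale hm,
        ← EReal.coe_le_coe_iff] at this
    · have := h2 (m.separated σ')
      rwa [J_separated_toAttack hm, J_separated_toAttack hm, scale_le_scale hm,
        ← EReal.coe_le_coe_iff] at this
  · rintro ⟨h1, h2⟩
    refine ⟨fun a => ?_, fun pol => ?_⟩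
    · obtain ⟨α', hα'⟩ := exists_best_attack hm σ
      rw [J_separated_toAttack hm, J_separated hm, scale_le_scale hm]
      exact (hα' a).trans (EReal.coe_le_coe_iff.mp (h1 α'))
    · obtain ⟨σ', hσ'⟩ := exists_best_sched hm α
      rw [J_separated_toAttack hm]
      exact le_J_of_forall_le hm
        (fun r => (EReal.coe_le_coe_iff.mp (h2 σ')).trans (hσ' r)) pol

theorem isMinimax_iff {m : Model nx nu ny} (hm : m.Valid) (σ : HoldingPolicy) :
    IsMinimax m.J (m.separated σ) ↔ IsMinimax (fun σ α => (m.Jred σ α : EReal)) σ := by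
  obtain ⟨c, hc, hc'⟩ := exists_worst_case hm σ
  constructor
  · intro h σ'
    obtain ⟨d, hd, hd'⟩ := exists_worst_case hm σ'
    have := h (m.separated σ')
    rw [hc', hd', scale_le_scale hm] at this
    rw [hc, hd]
    exact EReal.coe_le_coe_iff.mpr this
  · intro h pol
    -- an optimal attack secures the value against every strategy of the controller
    obtain ⟨σ₀, α₀, h1, h2⟩ := exists_saddle_histTotal hm
    have hv : c ≤ m.Jred σ₀ α₀ := by
      have h3 := h σ₀
      rw [hc] at h3
      refine EReal.coe_le_coe_iff.mp (h3.trans (iSup_le fun α => ?_))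
      rw [EReal.coe_le_coe_iff, ← histTotal_toAttack]
      exact h1 _
    rw [hc']
    exact ((scale_le_scale hm).mpr hv).trans
      (le_iSup_of_le (α₀.toAttack m.t0) (le_J_of_forall_le hm h2 pol))

theorem isMaximin_iff {m : Model nx nu ny} (hm : m.Valid) (α : HoldingPolicy) :
    IsMaximin m.J (α.toAttack m.t0) ↔ IsMaximin (fun σ α => (m.Jred σ α : EReal)) α := by
  obtain ⟨c, hc, hc'⟩ := exists_best_case hm α
  constructor
  · intro h α'
    obtain ⟨d, hd, hd'⟩ := exists_best_case hm α'
    have := h (α'.toAttack m.t0)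
    rw [hc', hd', scale_le_scale hm] at this
    rw [hc, hd]
    exact EReal.coe_le_coe_iff.mpr this
  · intro h a
    -- an optimal scheduling rule secures the value against every attack
    obtain ⟨σ₀, α₀, h1, h2⟩ := exists_saddle_histTotal hm
    have hv : m.Jred σ₀ α₀ ≤ c := by
      have h3 := h α₀
      rw [hc] at h3
      refine EReal.coe_le_coe_iff.mp (le_trans (le_iInf fun σ => ?_) h3)
      rw [EReal.coe_le_coe_iff, ← histTotal_toAttack m σ]
      exact h2 _
    rw [hc']
    refine iInf_le_of_le (m.separated σ₀) ?_
    rw [J_separated hm, scale_le_scale hm]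
    exact (h1 a).trans hv

theorem exists_value {m : Model nx nu ny} (hm : m.Valid) :
    ∃ val : ℝ,
      (⨅ σ, ⨆ α, (m.Jred σ α : EReal)) = (val : EReal) ∧
      (⨆ α, ⨅ σ, (m.Jred σ α : EReal)) = (val : EReal) ∧
      (⨅ pol, ⨆ α, m.J pol α) = ((m.scale val : ℝ) : EReal) ∧
      (⨆ α, ⨅ pol, m.J pol α) = ((m.scale val : ℝ) : EReal) := by
  obtain ⟨σ, α, h1, h2⟩ := exists_saddle_histTotal hm
  have g1 : ∀ α', (m.Jred σ α' : EReal) ≤ m.Jred σ α := fun α' => by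
    rw [EReal.coe_le_coe_iff, ← histTotal_toAttack]
    exact h1 _
  have g2 : ∀ σ', (m.Jred σ α : EReal) ≤ m.Jred σ' α := fun σ' => by
    rw [EReal.coe_le_coe_iff, ← histTotal_toAttack m σ']
    exact h2 _
  have f1 : ∀ a, m.J (m.separated σ) a ≤ (m.scale (m.Jred σ α) : ℝ) := fun a => by
    rw [J_separated hm, scale_le_scale hm]
    exact h1 a
  have f2 := le_J_of_forall_le hm h2
  exact ⟨m.Jred σ α,
    le_antisymm (iInf_le_of_le σ (iSup_le g1)) (le_iInf fun σ' => le_iSup_of_le α (g2 σ')),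
    le_antisymm (iSup_le fun α' => iInf_le_of_le σ (g1 α')) (le_iSup_of_le α (le_iInf g2)),
    le_antisymm (iInf_le_of_le (m.separated σ) (iSup_le f1))
      (le_iInf fun pol => le_iSup_of_le (α.toAttack m.t0) (f2 pol)),
    le_antisymm (iSup_le fun a => iInf_le_of_le (m.separated σ) (f1 a))
      (le_iSup_of_le (α.toAttack m.t0) (le_iInf f2))⟩

end Model

end DoSGame

end

theorem corollary1 {nx nu ny : ℕ} (m : DoSGame.Model nx nu ny) (hm : m.Valid) :
    -- every best response of the controller uses the linear control
    (∀ (pol : DoSGame.ControllerPolicy nx nu) (α : DoSGame.AttackPolicy),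
      (∀ pol', m.J pol α ≤ m.J pol' α) →
        ∀ k ≤ m.K, ∀ᵐ ω ∂m.law, m.inputAt pol α k ω = -(m.L k *ᵥ m.estimateAt pol α k ω)) ∧
    -- cost of the separated strategies
    (∀ σ α : DoSGame.HoldingPolicy,
      m.J (m.separated σ) (α.toAttack m.t0) =
        (((m.K : ℝ)⁻¹ * (m.baseCost + m.Jred σ α) : ℝ) : EReal)) ∧
    -- the scheduling and attack policies are optimal in the full game iff they are optimal in the
    -- complete-information game
    (∀ σ α : DoSGame.HoldingPolicy,
      DoSGame.IsNash m.J (m.separated σ) (α.toAttack m.t0) ↔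
        DoSGame.IsNash (fun σ α => (m.Jred σ α : EReal)) σ α) ∧
    (∀ σ : DoSGame.HoldingPolicy,
      DoSGame.IsMinimax m.J (m.separated σ) ↔
        DoSGame.IsMinimax (fun σ α => (m.Jred σ α : EReal)) σ) ∧
    (∀ α : DoSGame.HoldingPolicy,
      DoSGame.IsMaximin m.J (α.toAttack m.t0) ↔
        DoSGame.IsMaximin (fun σ α => (m.Jred σ α : EReal)) α) ∧
    -- the complete-information game has an equilibrium, and the values agree
    (∃ σ α : DoSGame.HoldingPolicy,
      DoSGame.IsNash (fun σ α => (m.Jred σ α : EReal)) σ α) ∧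
    (∃ val : ℝ,
      (⨅ σ, ⨆ α, (m.Jred σ α : EReal)) = (val : EReal) ∧
      (⨆ α, ⨅ σ, (m.Jred σ α : EReal)) = (val : EReal) ∧
      (⨅ pol, ⨆ α, m.J pol α) = (((m.K : ℝ)⁻¹ * (m.baseCost + val) : ℝ) : EReal) ∧
      (⨆ α, ⨅ pol, m.J pol α) = (((m.K : ℝ)⁻¹ * (m.baseCost + val) : ℝ) : EReal)) := by
  refine ⟨fun pol α h k hk => ?_, fun σ α => DoSGame.Model.J_separated_toAttack hm σ α,
    DoSGame.Model.isNash_iff hm, DoSGame.Model.isMinimax_iff hm, DoSGame.Model.isMaximin_iff hm,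
    ?_, DoSGame.Model.exists_value hm⟩
  · obtain ⟨r, hr⟩ := m.exists_describes pol α
    exact DoSGame.Model.input_eq_of_totalDeviation_eq_zero hm
      (DoSGame.Model.totalDeviation_eq_zero hm hr (h _)) hk
  · obtain ⟨σ, α, h1, h2⟩ := DoSGame.Model.exists_saddle_histTotal hm
    refine ⟨σ, α, fun α' => ?_, fun σ' => ?_⟩
    · rw [EReal.coe_le_coe_iff, ← DoSGame.Model.histTotal_toAttack]
      exact h1 _
    · rw [EReal.coe_le_coe_iff, ← DoSGame.Model.histTotal_toAttack m σ']
      exact h2 _
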